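/- Let $n\ge 2$ be an integer, let $a>r>0$, and let $T$ be the torus of revolution in $\mathbb R^3$ parametrized by $$X(u,v)=\big((a+r\cos u)\cos v,\ (a+r\cos u)\sin v,\ r\sin u\big),$$ which is $2\pi$-periodic in $u$ and in $v$. For a real polynomial $\mathcal E_n(H)=a_1H^n+a_2H^{n-1}+\dots+a_nH+a_{n+1}$ with $a_1\neq 0$ and a real number $p$, consider the functional $$\mathcal F_n(S)=\int_S \mathcal E_n(H)\,dA+p\int_V dV$$ on closed surfaces $S$ in $\mathbb R^3$, where $H$ is the mean curvature of $S$ (half the sum of the principal curvatures with respect to the unit normal $N=X_u\times X_v/|X_u\times X_v|$, which for $T$ is the inner normal) and $V$ is the region enclosed by $S$. The torus $T$ is called a critical point of $\mathcal F_n$ if for every smooth function $\Omega$ on $T$ the function $t\mapsto \mathcal F_n(T_t)$, where $T_t$ is the surface parametrized by $X+t\,\Omega\,N$, has derivative $0$ at $t=0$. Then for every real $a_1\ne 0$ the following are equivalent: 1. there are real numbers $a_2,\dots,a_{n+1}$ and $p$ such that $T$ is a critical point of the functional $\mathcal F_n$ with these coefficients; 2. $\displaystyle \frac{a^2}{r^2}=\frac{n^2-n}{n^2-n-1}$.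 -/

import Mathlib

open scoped ContDiff

noncomputable section

namespace ToroidalSurface

/-- Euclidean three-space. -/
abbrev E3 : Type := EuclideanSpace ℝ (Fin 3)

/-- The cross product in Euclidean three-space. -/
def cross (x y : E3) : E3 := WithLp.toLp 2 (crossProduct (WithLp.ofLp x) (WithLp.ofLp y))

/-- Partial derivative in the first parameter `u`. -/
def partialU (X : ℝ → ℝ → E3) (u v : ℝ) : E3 := deriv (fun s => X s v) u

/-- Partial derivative in the second parameter `v`. -/
def partialV (X : ℝ → ℝ → E3) (u v : ℝ) : E3 := deriv (fun s => X u s) v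

/-- The area density `|X_u × X_v|`, so that `dA = |X_u × X_v| du dv`. -/
def areaDensity (X : ℝ → ℝ → E3) (u v : ℝ) : ℝ :=
  ‖cross (partialU X u v) (partialV X u v)‖

/-- The unit normal `N = (X_u × X_v) / |X_u × X_v|`. -/
def unitNormal (X : ℝ → ℝ → E3) (u v : ℝ) : E3 :=
  (areaDensity X u v)⁻¹ • cross (partialU X u v) (partialV X u v)

/-- Coefficients of the first fundamental form. -/
def g11 (X : ℝ → ℝ → E3) (u v : ℝ) : ℝ := inner ℝ (partialU X u v) (partialU X u v)

def g12 (X : ℝ → ℝ → E3) (u v : ℝ) : ℝ := inner ℝ (partialU X u v) (partialV X u v)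

def g22 (X : ℝ → ℝ → E3) (u v : ℝ) : ℝ := inner ℝ (partialV X u v) (partialV X u v)

/-- Coefficients of the second fundamental form, with respect to `unitNormal`. -/
def h11 (X : ℝ → ℝ → E3) (u v : ℝ) : ℝ :=
  inner ℝ (partialU (partialU X) u v) (unitNormal X u v)

def h12 (X : ℝ → ℝ → E3) (u v : ℝ) : ℝ :=
  inner ℝ (partialV (partialU X) u v) (unitNormal X u v)

def h22 (X : ℝ → ℝ → E3) (u v : ℝ) : ℝ :=
  inner ℝ (partialV (partialV X) u v) (unitNormal X u v)

/-- The mean curvature `H = (1/2) g^{ij} h_{ij}`. -/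
def meanCurvature (X : ℝ → ℝ → E3) (u v : ℝ) : ℝ :=
  (g22 X u v * h11 X u v - 2 * g12 X u v * h12 X u v + g11 X u v * h22 X u v) /
    (2 * (g11 X u v * g22 X u v - g12 X u v ^ 2))

/-- The surface in space traced out by a parametrization. -/
def surface (X : ℝ → ℝ → E3) : Set E3 := Set.range (fun q : ℝ × ℝ => X q.1 q.2)

/-- The region enclosed by a set `S`: the union of the bounded connected components of the
complement of `S`. -/
def enclosedRegion (S : Set E3) : Set E3 :=
  {x | x ∉ S ∧ Bornology.IsBounded (connectedComponentIn Sᶜ x)}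

/-- The volume (Lebesgue measure) enclosed by a set. -/
def enclosedVolume (S : Set E3) : ℝ := (MeasureTheory.volume (enclosedRegion S)).toReal

/-- The functional `∫_S E(H) dA + p ∫_V dV`, for a surface given by a parametrization which
is `2π`-periodic in both parameters and covers the surface once over a period square. -/
def shapeEnergy (E : Polynomial ℝ) (p : ℝ) (X : ℝ → ℝ → E3) : ℝ :=
  (∫ u in (0 : ℝ)..(2 * Real.pi), ∫ v in (0 : ℝ)..(2 * Real.pi),
      E.eval (meanCurvature X u v) * areaDensity X u v) +
    p * enclosedVolume (surface X)

/-- A smooth function on the torus, seen as a smooth function of `(u, v)` which is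
`2π`-periodic in each variable. -/
def IsSmoothPeriodic (Ω : ℝ → ℝ → ℝ) : Prop :=
  ContDiff ℝ ∞ (fun q : ℝ × ℝ => Ω q.1 q.2) ∧
    (∀ u v, Ω (u + 2 * Real.pi) v = Ω u v) ∧ (∀ u v, Ω u (v + 2 * Real.pi) = Ω u v)

/-- The normal variation `X + t Ω N`. -/
def normalVariation (X : ℝ → ℝ → E3) (Ω : ℝ → ℝ → ℝ) (t : ℝ) (u v : ℝ) : E3 :=
  X u v + (t * Ω u v) • unitNormal X u v

/-- `X` is a critical point of `∫_S E(H) dA + p ∫_V dV`: for every smooth function `Ω` on the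
surface the first variation along `Ω N` exists and vanishes. -/
def IsCriticalPoint (E : Polynomial ℝ) (p : ℝ) (X : ℝ → ℝ → E3) : Prop :=
  ∀ Ω : ℝ → ℝ → ℝ, IsSmoothPeriodic Ω →
    HasDerivAt (fun t : ℝ => shapeEnergy E p (normalVariation X Ω t)) 0 0

/-- The torus of revolution with radii `a` and `r`. -/
def torus (a r : ℝ) (u v : ℝ) : E3 :=
  !₂[(a + r * Real.cos u) * Real.cos v, (a + r * Real.cos u) * Real.sin v, r * Real.sin u]

end ToroidalSurface

end

/-! Since `N` points towards the core circle, the surface `X + t Ω N` is the tube around that circle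
with radius `r - t Ω`. Area density, mean curvature and enclosed volume of such tubes are explicit,
so the first variation can be computed directly. After integration by parts it is the integral of
`Ω` against `ΔE'(H)/2 + (2H² - K) E'(H) - 2H E(H) - p`, and criticality is the vanishing of this
function (`hasDerivAt_shapeEnergy`, `isCriticalPoint_torus_iff`).

On the torus everything depends on `y = 1/(a + r cos u)` alone: `H = 1/r - a y/(2r)`, `K = (1 - a
y)/r²`, and the Laplacian acts on functions of `y` with polynomial coefficients. Writing `E(H) =
e(y)`, the equation becomes the polynomial identity `eulerOp a r e = C p`, because `y` takes
infinitely many values.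

For `m ≥ 2` the operator sends `X^m` to degree at most `m + 1`, with top coefficient
`(m-1)(m(m-1)(a² - r²) - a²)/(ar)` (`coeff_eulerOp_X_pow`). A solution of degree `n` makes this
vanish at `m = n`, which is the stated ratio. Conversely, `m(m-1)` is strictly increasing, so if it
vanishes at `n` it vanishes at no other `m ≥ 2`, and the lower coefficients of `e` are found by
triangular elimination. The one degree missed by the leading terms, degree two, never occurs in the
image (`coeff_two_eulerOp_X_pow`), so there is no obstruction. -/

noncomputable section

/-! ### Algebra of the Euler–Lagrange operator on polynomials in `y`. -/

namespace ToroidalSurface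

open Polynomial

/-- The Euler–Lagrange operator of the torus, acting on the energy density written as a
polynomial in `y = 1 / (a + r cos u)`. -/
def eulerOp (a r : ℝ) : ℝ[X] →ₗ[ℝ] ℝ[X] where
  toFun e :=
    -- `G` is `E'(H)`, since `dy/dH = -2r/a`. The three groups below are `ΔG/2`, `(2H² - K) G` and
    -- `2H e`; the Laplacian coefficients come from `r² sin² u = r² - (1/y - a)²`.
    let G := C (-(2 * r / a)) * derivative e
    C (1 / (2 * r ^ 2)) *
        ((C (r ^ 2 - a ^ 2) * X ^ 4 + C (2 * a) * X ^ 3 - X ^ 2) * derivative (derivative G) +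
          (C (r ^ 2 - a ^ 2) * X ^ 3 + C a * X ^ 2) * derivative G) +
      (C (a ^ 2 / (2 * r ^ 2)) * X ^ 2 - C (a / r ^ 2) * X + C (1 / r ^ 2)) * G -
      (C (2 / r) - C (a / r) * X) * e
  map_add' x y := by simp only [derivative_add, mul_add]; ring
  map_smul' s x := by
    simp only [smul_eq_C_mul, derivative_C_mul, RingHom.id_apply]; ring

theorem eulerOp_one {a r : ℝ} : eulerOp a r 1 = C (a / r) * X - C (2 / r) := by
  simp [eulerOp]

/-- A term linear in `y` only shifts `p`, so it gives no freedom in positive degrees. -/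
theorem eulerOp_X {a r : ℝ} (ha : a ≠ 0) (hr : r ≠ 0) :
    eulerOp a r X = C (-(2 / (a * r))) := by
  refine Polynomial.funext fun y => ?_
  simp [eulerOp]
  field_simp
  ring

theorem eulerOp_X_sq {a r : ℝ} (ha : a ≠ 0) (hr : r ≠ 0) :
    eulerOp a r (X ^ 2) = C ((a ^ 2 - 2 * r ^ 2) / (a * r)) * X ^ 3 - C (4 / (a * r)) * X := by
  refine Polynomial.funext fun y => ?_
  simp [eulerOp]
  field_simp
  ring

/-- Three derivatives fall on the monomial, one in `G` and two in the Laplacian; the exponent `k +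
3` keeps subtraction on naturals out of the formula. -/
theorem eulerOp_X_pow_add_three {a r : ℝ} (ha : a ≠ 0) (hr : r ≠ 0) (k : ℕ) :
    eulerOp a r (X ^ (k + 3)) =
      C (((k : ℝ) + 2) * ((k + 3) * (k + 2) * (a ^ 2 - r ^ 2) - a ^ 2) / (a * r)) * X ^ (k + 4) -
        C (((k : ℝ) + 2) * (k + 1) * (2 * k + 7) / r) * X ^ (k + 3) +
        C (((k : ℝ) + 3) ^ 2 * k / (a * r)) * X ^ (k + 2) := by
  refine Polynomial.funext fun y => ?_
  have h (j : ℕ) : derivative (X ^ (j + 1) : ℝ[X]) = C ((j : ℝ) + 1) * X ^ j := by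
    simp
  simp only [eulerOp, LinearMap.coe_mk, AddHom.coe_mk, h (k + 2), h (k + 1), h k,
    derivative_C_mul, eval_add, eval_sub, eval_mul, eval_C, eval_pow, eval_X]
  push_cast
  field_simp
  ring

theorem natDegree_eulerOp_X_pow_le {a r : ℝ} (ha : a ≠ 0) (hr : r ≠ 0) (m : ℕ) :
    (eulerOp a r (X ^ m)).natDegree ≤ m + 1 := by
  match m with
  | 0 => rw [pow_zero, eulerOp_one]; compute_degree
  | 1 => rw [pow_one, eulerOp_X ha hr, natDegree_C]; omega
  | 2 => rw [eulerOp_X_sq ha hr]; compute_degree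
  | k + 3 => rw [eulerOp_X_pow_add_three ha hr]; compute_degree

/-- The source of the critical ratio: for `m ≥ 2` this coefficient is zero exactly when `m(m-1)(a² -
r²) = a²`. -/
theorem coeff_eulerOp_X_pow {a r : ℝ} (ha : a ≠ 0) (hr : r ≠ 0) {m : ℕ} (hm : 2 ≤ m) :
    (eulerOp a r (X ^ m)).coeff (m + 1) =
      ((m : ℝ) - 1) * (m * (m - 1) * (a ^ 2 - r ^ 2) - a ^ 2) / (a * r) := by
  match m, hm with
  | 2, _ =>
    rw [eulerOp_X_sq ha hr]; simp [coeff_C_mul, -map_mul]; ring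
  | k + 3, _ =>
    rw [eulerOp_X_pow_add_three ha hr]
    simp only [coeff_add, coeff_sub, coeff_C_mul, coeff_X_pow]
    norm_num
    ring

/-- Degree two could only arise from `m = 1, 2, 3`, and there the coefficient happens to vanish; for
`m = 3` this is the factor `k` of the lowest term. Leading terms have degree 1, 0 and `m + 1 ≥ 3`,
so a nonzero quadratic term could not be eliminated. -/
theorem coeff_two_eulerOp_X_pow {a r : ℝ} (ha : a ≠ 0) (hr : r ≠ 0) (m : ℕ) :
    (eulerOp a r (X ^ m)).coeff 2 = 0 := by
  match m with
  | 0 => rw [pow_zero, eulerOp_one]; simp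
  | 1 => rw [pow_one, eulerOp_X ha hr]; simp
  | 2 => rw [eulerOp_X_sq ha hr]; simp [coeff_C_mul, coeff_X_pow, -map_mul]
  | 0 + 3 =>
    rw [eulerOp_X_pow_add_three ha hr]
    simp only [coeff_add, coeff_sub, coeff_C_mul, coeff_X_pow]
    norm_num
  | k + 1 + 3 =>
    rw [eulerOp_X_pow_add_three ha hr]
    simp only [coeff_add, coeff_sub, coeff_C_mul, coeff_X_pow]
    norm_num

theorem eulerOp_eq_sum (a r : ℝ) (e : ℝ[X]) :
    eulerOp a r e = ∑ m ∈ Finset.range (e.natDegree + 1), e.coeff m • eulerOp a r (X ^ m) := by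
  conv_lhs => rw [e.as_sum_range_C_mul_X_pow]
  simp [map_sum, ← smul_eq_C_mul]

theorem coeff_eulerOp_natDegree_succ {a r : ℝ} (ha : a ≠ 0) (hr : r ≠ 0) {e : ℝ[X]}
    (he : 2 ≤ e.natDegree) :
    (eulerOp a r e).coeff (e.natDegree + 1) = e.leadingCoeff *
      (((e.natDegree : ℝ) - 1) *
        (e.natDegree * (e.natDegree - 1) * (a ^ 2 - r ^ 2) - a ^ 2) / (a * r)) := by
  rw [eulerOp_eq_sum, finsetSum_coeff, Finset.sum_range_succ, Finset.sum_eq_zero, zero_add,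
    coeff_smul, coeff_eulerOp_X_pow ha hr he]
  · rfl
  · intro m hm
    rw [coeff_smul, coeff_eq_zero_of_natDegree_lt (n := e.natDegree + 1), smul_zero]
    have := natDegree_eulerOp_X_pow_le ha hr m
    have := Finset.mem_range.1 hm
    omega

/-- Below the critical degree the equation `eulerOp e - p = b` can be solved, provided that the
quadratic coefficient of `b` vanishes. -/
theorem exists_eulerOp_sub_C_eq {a r : ℝ} (ha : a ≠ 0) (hr : r ≠ 0) (k : ℕ)
    (hk : ∀ m : ℕ, 2 ≤ m → m ≤ k → (m : ℝ) * (m - 1) * (a ^ 2 - r ^ 2) ≠ a ^ 2)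
    (b : ℝ[X]) (hb : b.natDegree ≤ k + 1) (hb2 : b.coeff 2 = 0) :
    ∃ (e : ℝ[X]) (p : ℝ), e.natDegree ≤ k ∧ eulerOp a r e - C p = b := by
  have base : ∀ b : ℝ[X], b.natDegree ≤ 1 →
      ∃ (e : ℝ[X]) (p : ℝ), e.natDegree ≤ 0 ∧ eulerOp a r e - C p = b := by
    intro b hb
    -- A constant energy matches the linear coefficient through `eulerOp_one`; `p` absorbs the
    -- constant one.
    refine ⟨(b.coeff 1 * r / a) • 1, -(2 / r) * (b.coeff 1 * r / a) - b.coeff 0, ?_, ?_⟩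
    · exact (natDegree_smul_le _ _).trans (by simp)
    · rw [map_smul, eulerOp_one]
      conv_rhs => rw [eq_X_add_C_of_natDegree_le_one hb]
      refine Polynomial.funext fun y => ?_
      simp
      field_simp
      ring
  induction k generalizing b with
  | zero => exact base b hb
  | succ k ih =>
    obtain rfl | hk0 := Nat.eq_zero_or_pos k
    -- Here the degree bound is two, and the vanishing quadratic coefficient lowers it to one.
    · obtain ⟨e, p, he, h⟩ := base b (by
        rw [natDegree_le_iff_coeff_eq_zero]
        intro N hN
        obtain rfl | hN2 := (show 2 ≤ N from hN).eq_or_lt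
        · exact hb2
        · exact coeff_eq_zero_of_natDegree_lt (by omega))
      exact ⟨e, p, by omega, h⟩
    · set m := k + 1 with hm
      have hm2 : 2 ≤ m := by omega
      set l := (eulerOp a r (X ^ m)).coeff (m + 1) with hl
      have hl0 : l ≠ 0 := by
        rw [hl, coeff_eulerOp_X_pow ha hr hm2]
        have h2 : (2 : ℝ) ≤ m := by exact_mod_cast hm2
        exact div_ne_zero (mul_ne_zero (by linarith) (sub_ne_zero.2 (hk m hm2 le_rfl)))
          (mul_ne_zero ha hr)
      -- Elimination: a multiple of the image of `X^m` removes the top coefficient and leaves the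
      -- quadratic one zero.
      obtain ⟨e, p, he, h⟩ := ih (fun j hj hjk => hk j hj (by omega))
        (b - (b.coeff (m + 1) / l) • eulerOp a r (X ^ m)) (by
          rw [natDegree_le_iff_coeff_eq_zero]
          intro N hN
          obtain rfl | hN2 := (show m + 1 ≤ N from hN).eq_or_lt
          · rw [coeff_sub, coeff_smul, ← hl, smul_eq_mul, div_mul_cancel₀ _ hl0, sub_self]
          · rw [coeff_sub, coeff_smul, coeff_eq_zero_of_natDegree_lt (by omega),
              coeff_eq_zero_of_natDegree_lt
                ((natDegree_eulerOp_X_pow_le ha hr m).trans_lt hN2), smul_zero, sub_zero])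
        (by rw [coeff_sub, coeff_smul, hb2, coeff_two_eulerOp_X_pow ha hr, smul_zero, sub_zero])
      refine ⟨e + (b.coeff (m + 1) / l) • X ^ m, p, ?_, ?_⟩
      · refine natDegree_add_le_of_degree_le (by omega) ?_
        exact (natDegree_smul_le _ _).trans (by simp)
      · rw [map_add, map_smul, add_sub_right_comm, h, sub_add_cancel]

/-- At the critical degree the image of `X^n` loses its top term and has degree at most `n`, so it
can be cancelled by the image of a polynomial of degree below `n`, up to a constant. -/
theorem exists_eulerOp_eq_C {a r : ℝ} (hr : 0 < r) (har : r < a) {n : ℕ} (hn : 2 ≤ n)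
    (h : (n : ℝ) * (n - 1) * (a ^ 2 - r ^ 2) = a ^ 2) {α : ℝ} (hα : α ≠ 0) :
    ∃ (e : ℝ[X]) (p : ℝ), e.natDegree = n ∧ e.leadingCoeff = α ∧ eulerOp a r e = C p := by
  have ha : a ≠ 0 := (hr.trans har).ne'
  have hD : 0 < a ^ 2 - r ^ 2 := by nlinarith
  obtain ⟨k, rfl⟩ : ∃ k, n = k + 1 := ⟨n - 1, by omega⟩
  have hdeg : (eulerOp a r (X ^ (k + 1))).natDegree ≤ k + 1 := by
    rw [natDegree_le_iff_coeff_eq_zero]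
    intro N hN
    obtain rfl | hN2 := (show k + 1 + 1 ≤ N from hN).eq_or_lt
    · rw [coeff_eulerOp_X_pow ha hr.ne' hn, h]; simp
    · exact coeff_eq_zero_of_natDegree_lt
        ((natDegree_eulerOp_X_pow_le ha hr.ne' _).trans_lt hN2)
  obtain ⟨e, p, he, hp⟩ := exists_eulerOp_sub_C_eq ha hr.ne' k
    -- No smaller degree is critical, because `m(m-1)` is strictly increasing and `a² - r² > 0`.
    (fun m hm hmk => by
      refine fun h0 => absurd (h0.trans h.symm) ?_
      have h1 : (m : ℝ) ≤ k := by exact_mod_cast hmk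
      have h2 : (2 : ℝ) ≤ m := by exact_mod_cast hm
      refine (mul_lt_mul_of_pos_right ?_ hD).ne
      push_cast
      nlinarith)
    (-(α • eulerOp a r (X ^ (k + 1))))
    ((natDegree_neg _).le.trans ((natDegree_smul_le _ _).trans hdeg))
    (by rw [coeff_neg, coeff_smul, coeff_two_eulerOp_X_pow ha hr.ne', smul_zero, neg_zero])
  have hlt : e.degree < (C α * X ^ (k + 1)).degree := by
    rw [degree_C_mul_X_pow _ hα]
    exact (degree_le_natDegree).trans_lt (by exact_mod_cast Nat.lt_succ_of_le he)
  refine ⟨e + C α * X ^ (k + 1), p, ?_, ?_, ?_⟩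
  · rw [natDegree_add_eq_right_of_degree_lt hlt, natDegree_C_mul_X_pow _ _ hα]
  · rw [leadingCoeff_add_of_degree_lt hlt, leadingCoeff_C_mul_X_pow]
  · rw [map_add, ← smul_eq_C_mul, map_smul]
    linear_combination hp

end ToroidalSurface

/-! ### First and second fundamental forms of tubes of variable radius. -/

namespace ToroidalSurface

theorem hasDerivAt_vec3 {f g h : ℝ → ℝ} {f' g' h' x : ℝ} (hf : HasDerivAt f f' x)
    (hg : HasDerivAt g g' x) (hh : HasDerivAt h h' x) :
    HasDerivAt (fun s => (!₂[f s, g s, h s] : E3)) !₂[f', g', h'] x := by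
  rw [hasDerivAt_iff_hasFDerivAt, ← hasFDerivWithinAt_univ, hasFDerivWithinAt_euclidean]
  intro i
  fin_cases i
  · exact hf.hasFDerivAt.hasFDerivWithinAt
  · exact hg.hasFDerivAt.hasFDerivWithinAt
  · exact hh.hasFDerivAt.hasFDerivWithinAt

theorem inner_vec3 (x₁ x₂ x₃ y₁ y₂ y₃ : ℝ) :
    inner ℝ (!₂[x₁, x₂, x₃] : E3) !₂[y₁, y₂, y₃] = x₁ * y₁ + x₂ * y₂ + x₃ * y₃ := by
  simp [PiLp.inner_apply, Fin.sum_univ_three]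
  ring

theorem cross_vec3 (x₁ x₂ x₃ y₁ y₂ y₃ : ℝ) :
    cross !₂[x₁, x₂, x₃] !₂[y₁, y₂, y₃] =
      !₂[x₂ * y₃ - x₃ * y₂, x₃ * y₁ - x₁ * y₃, x₁ * y₂ - x₂ * y₁] := by
  ext i
  fin_cases i <;> simp [cross, crossProduct]

theorem norm_vec3 (x₁ x₂ x₃ : ℝ) :
    ‖(!₂[x₁, x₂, x₃] : E3)‖ = √(x₁ ^ 2 + x₂ ^ 2 + x₃ ^ 2) := by
  simp [EuclideanSpace.norm_eq, Fin.sum_univ_three]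

/-- The tube of variable radius `ρ` around the circle of radius `a`. -/
def tube (a : ℝ) (ρ : ℝ → ℝ → ℝ) (u v : ℝ) : E3 :=
  !₂[(a + ρ u v * Real.cos u) * Real.cos v, (a + ρ u v * Real.cos u) * Real.sin v,
    ρ u v * Real.sin u]

/-- The square of the area density of a tube, in terms of the 1-jet of its radius. -/
def tubeAreaSq (a c ρ ρu ρv : ℝ) : ℝ :=
  ρu ^ 2 * (a + ρ * c) ^ 2 + ρ ^ 2 * ρv ^ 2 + ρ ^ 2 * (a + ρ * c) ^ 2

/-- The numerator of the mean curvature of a tube, in terms of the 2-jet of its radius. -/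
def tubeCurvNum (a c s ρ ρu ρv ρuu ρuv ρvv : ℝ) : ℝ :=
  (ρv ^ 2 + (a + ρ * c) ^ 2) * (2 * ρu ^ 2 * (a + ρ * c) - (ρuu - ρ) * ρ * (a + ρ * c)) -
    2 * (ρu * ρv) * (ρv * ρu * (a + ρ * c) + (ρu * c - ρ * s) * ρ * ρv - ρuv * ρ * (a + ρ * c)) +
    (ρu ^ 2 + ρ ^ 2) * ((a + ρ * c) ^ 2 * s * ρu + 2 * ρv ^ 2 * c * ρ -
      (ρvv - (a + ρ * c) * c) * ρ * (a + ρ * c))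

section

variable {a : ℝ} {ρ ρu ρv ρuu ρuv ρvv : ℝ → ℝ → ℝ}

theorem partialU_tube (hu : ∀ u v, HasDerivAt (fun s => ρ s v) (ρu u v) u) :
    partialU (tube a ρ) = fun u v =>
      !₂[(ρu u v * Real.cos u - ρ u v * Real.sin u) * Real.cos v,
        (ρu u v * Real.cos u - ρ u v * Real.sin u) * Real.sin v,
        ρu u v * Real.sin u + ρ u v * Real.cos u] := by
  funext u v
  have hw := ((hu u v).mul (Real.hasDerivAt_cos u)).const_add a
  refine (hasDerivAt_vec3 (hw.mul_const (Real.cos v)) (hw.mul_const (Real.sin v))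
    ((hu u v).mul (Real.hasDerivAt_sin u))).deriv.trans ?_
  congr 2 <;> simp <;> ring_nf <;> simp

theorem partialV_tube (hv : ∀ u v, HasDerivAt (fun s => ρ u s) (ρv u v) v) :
    partialV (tube a ρ) = fun u v =>
      !₂[ρv u v * Real.cos u * Real.cos v - (a + ρ u v * Real.cos u) * Real.sin v,
        ρv u v * Real.cos u * Real.sin v + (a + ρ u v * Real.cos u) * Real.cos v,
        ρv u v * Real.sin u] := by
  funext u v
  have hw := ((hv u v).mul_const (Real.cos u)).const_add a
  refine (hasDerivAt_vec3 (hw.mul (Real.hasDerivAt_cos v)) (hw.mul (Real.hasDerivAt_sin v))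
    ((hv u v).mul_const (Real.sin u))).deriv.trans ?_
  congr 2
  simp
  ring_nf

theorem partialU_partialU_tube (hu : ∀ u v, HasDerivAt (fun s => ρ s v) (ρu u v) u)
    (huu : ∀ u v, HasDerivAt (fun s => ρu s v) (ρuu u v) u) :
    partialU (partialU (tube a ρ)) = fun u v =>
      !₂[((ρuu u v - ρ u v) * Real.cos u - 2 * ρu u v * Real.sin u) * Real.cos v,
        ((ρuu u v - ρ u v) * Real.cos u - 2 * ρu u v * Real.sin u) * Real.sin v,
        (ρuu u v - ρ u v) * Real.sin u + 2 * ρu u v * Real.cos u] := by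
  rw [partialU_tube hu]
  funext u v
  have hw := ((huu u v).mul (Real.hasDerivAt_cos u)).sub ((hu u v).mul (Real.hasDerivAt_sin u))
  refine (hasDerivAt_vec3 (hw.mul_const (Real.cos v)) (hw.mul_const (Real.sin v))
    (((huu u v).mul (Real.hasDerivAt_sin u)).add
      ((hu u v).mul (Real.hasDerivAt_cos u)))).deriv.trans ?_
  congr 2 <;> simp <;> ring_nf <;> simp

theorem partialV_partialU_tube (hu : ∀ u v, HasDerivAt (fun s => ρ s v) (ρu u v) u)
    (hv : ∀ u v, HasDerivAt (fun s => ρ u s) (ρv u v) v)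
    (huv : ∀ u v, HasDerivAt (fun s => ρu u s) (ρuv u v) v) :
    partialV (partialU (tube a ρ)) = fun u v =>
      !₂[(ρuv u v * Real.cos u - ρv u v * Real.sin u) * Real.cos v -
          (ρu u v * Real.cos u - ρ u v * Real.sin u) * Real.sin v,
        (ρuv u v * Real.cos u - ρv u v * Real.sin u) * Real.sin v +
          (ρu u v * Real.cos u - ρ u v * Real.sin u) * Real.cos v,
        ρuv u v * Real.sin u + ρv u v * Real.cos u] := by
  rw [partialU_tube hu]
  funext u v
  have hw := ((huv u v).mul_const (Real.cos u)).sub ((hv u v).mul_const (Real.sin u))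
  refine (hasDerivAt_vec3 (hw.mul (Real.hasDerivAt_cos v)) (hw.mul (Real.hasDerivAt_sin v))
    (((huv u v).mul_const (Real.sin u)).add ((hv u v).mul_const (Real.cos u)))).deriv.trans ?_
  congr 2
  simp
  ring_nf

theorem partialV_partialV_tube (hv : ∀ u v, HasDerivAt (fun s => ρ u s) (ρv u v) v)
    (hvv : ∀ u v, HasDerivAt (fun s => ρv u s) (ρvv u v) v) :
    partialV (partialV (tube a ρ)) = fun u v =>
      !₂[(ρvv u v * Real.cos u - (a + ρ u v * Real.cos u)) * Real.cos v -
          2 * ρv u v * Real.cos u * Real.sin v,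
        (ρvv u v * Real.cos u - (a + ρ u v * Real.cos u)) * Real.sin v +
          2 * ρv u v * Real.cos u * Real.cos v,
        ρvv u v * Real.sin u] := by
  rw [partialV_tube hv]
  funext u v
  have hw := ((hv u v).mul_const (Real.cos u)).const_add a
  have hz := (hvv u v).mul_const (Real.cos u)
  refine (hasDerivAt_vec3
    ((hz.mul (Real.hasDerivAt_cos v)).sub (hw.mul (Real.hasDerivAt_sin v)))
    ((hz.mul (Real.hasDerivAt_sin v)).add (hw.mul (Real.hasDerivAt_cos v)))
    ((hvv u v).mul_const (Real.sin u))).deriv.trans ?_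
  congr 2 <;> simp <;> ring_nf

theorem areaDensity_tube (hu : ∀ u v, HasDerivAt (fun s => ρ s v) (ρu u v) u)
    (hv : ∀ u v, HasDerivAt (fun s => ρ u s) (ρv u v) v) (u v : ℝ) :
    areaDensity (tube a ρ) u v =
      √(tubeAreaSq a (Real.cos u) (ρ u v) (ρu u v) (ρv u v)) := by
  rw [areaDensity, partialU_tube hu, partialV_tube hv, cross_vec3, norm_vec3, tubeAreaSq]
  have h1 := Real.sin_sq_add_cos_sq u
  have h2 := Real.sin_sq_add_cos_sq v
  congr 1
  grind

theorem meanCurvature_tube (hu : ∀ u v, HasDerivAt (fun s => ρ s v) (ρu u v) u)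
    (hv : ∀ u v, HasDerivAt (fun s => ρ u s) (ρv u v) v)
    (huu : ∀ u v, HasDerivAt (fun s => ρu s v) (ρuu u v) u)
    (huv : ∀ u v, HasDerivAt (fun s => ρu u s) (ρuv u v) v)
    (hvv : ∀ u v, HasDerivAt (fun s => ρv u s) (ρvv u v) v) (u v : ℝ) :
    meanCurvature (tube a ρ) u v =
      tubeCurvNum a (Real.cos u) (Real.sin u) (ρ u v) (ρu u v) (ρv u v) (ρuu u v) (ρuv u v)
          (ρvv u v) /
        (2 * (tubeAreaSq a (Real.cos u) (ρ u v) (ρu u v) (ρv u v) *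
          √(tubeAreaSq a (Real.cos u) (ρ u v) (ρu u v) (ρv u v)))) := by
  have h1 := Real.sin_sq_add_cos_sq u
  have h2 := Real.sin_sq_add_cos_sq v
  have e11 : g11 (tube a ρ) u v = ρu u v ^ 2 + ρ u v ^ 2 := by
    simp only [g11, partialU_tube hu, inner_vec3]; grind
  have e12 : g12 (tube a ρ) u v = ρu u v * ρv u v := by
    simp only [g12, partialU_tube hu, partialV_tube hv, inner_vec3]; grind
  have e22 : g22 (tube a ρ) u v = ρv u v ^ 2 + (a + ρ u v * Real.cos u) ^ 2 := by
    simp only [g22, partialV_tube hv, inner_vec3]; grind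
  set A := tubeAreaSq a (Real.cos u) (ρ u v) (ρu u v) (ρv u v) with hA
  have k11 : h11 (tube a ρ) u v = (√A)⁻¹ *
      (2 * ρu u v ^ 2 * (a + ρ u v * Real.cos u) -
        (ρuu u v - ρ u v) * ρ u v * (a + ρ u v * Real.cos u)) := by
    rw [h11, partialU_partialU_tube hu huu]
    simp only [unitNormal, inner_smul_right, areaDensity_tube hu hv, ← hA,
      partialU_tube hu, partialV_tube hv, cross_vec3, inner_vec3]
    congr 1; grind
  have k12 : h12 (tube a ρ) u v = (√A)⁻¹ *
      (ρv u v * ρu u v * (a + ρ u v * Real.cos u) +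
        (ρu u v * Real.cos u - ρ u v * Real.sin u) * ρ u v * ρv u v -
        ρuv u v * ρ u v * (a + ρ u v * Real.cos u)) := by
    rw [h12, partialV_partialU_tube hu hv huv]
    simp only [unitNormal, inner_smul_right, areaDensity_tube hu hv, ← hA,
      partialU_tube hu, partialV_tube hv, cross_vec3,
      inner_vec3]
    congr 1; grind
  have k22 : h22 (tube a ρ) u v = (√A)⁻¹ *
      ((a + ρ u v * Real.cos u) ^ 2 * Real.sin u * ρu u v +
        2 * ρv u v ^ 2 * Real.cos u * ρ u v -
        (ρvv u v - (a + ρ u v * Real.cos u) * Real.cos u) * ρ u v *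
          (a + ρ u v * Real.cos u)) := by
    rw [h22, partialV_partialV_tube hv hvv]
    simp only [unitNormal, inner_smul_right, areaDensity_tube hu hv, ← hA,
      partialU_tube hu, partialV_tube hv, cross_vec3, inner_vec3]
    congr 1; grind
  -- Lagrange's identity: the determinant of the metric is the squared area density.
  have hden : (ρu u v ^ 2 + ρ u v ^ 2) * (ρv u v ^ 2 + (a + ρ u v * Real.cos u) ^ 2) -
      (ρu u v * ρv u v) ^ 2 = A := by
    rw [hA, tubeAreaSq]; ring
  rw [meanCurvature, e11, e12, e22, k11, k12, k22, hden, tubeCurvNum, div_eq_mul_inv,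
    div_eq_mul_inv, mul_inv, mul_inv, mul_inv]
  ring

end

theorem torus_eq_tube (a r : ℝ) : torus a r = tube a (fun _ _ => r) := rfl

/-- The normal is the inner one, `-(cos u cos v, cos u sin v, sin u)`; moving along it shortens the
tube radius and keeps the angles. -/
theorem normalVariation_torus {a r : ℝ} (hr : 0 < r) (har : r < a) (Ω : ℝ → ℝ → ℝ) (t : ℝ) :
    normalVariation (torus a r) Ω t = tube a (fun u v => r - t * Ω u v) := by
  have h0 : ∀ u v : ℝ, HasDerivAt (fun _ : ℝ => r) ((fun _ _ => (0 : ℝ)) u v) u :=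
    fun u v => hasDerivAt_const u r
  have h0' : ∀ u v : ℝ, HasDerivAt (fun _ : ℝ => r) ((fun _ _ => (0 : ℝ)) u v) v :=
    fun u v => hasDerivAt_const v r
  funext u v
  have hw : 0 < a + r * Real.cos u := by nlinarith [Real.neg_one_le_cos u]
  have hA : areaDensity (tube a fun _ _ => r) u v = r * (a + r * Real.cos u) := by
    rw [areaDensity_tube (ρ := fun _ _ => r) h0 h0', tubeAreaSq, Real.sqrt_eq_iff_mul_self_eq]
    · ring
    · positivity
    · positivity
  rw [normalVariation, torus_eq_tube, unitNormal, hA, partialU_tube (ρ := fun _ _ => r) h0,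
    partialV_tube (ρ := fun _ _ => r) h0', cross_vec3]
  have h2 := Real.sin_sq_add_cos_sq v
  ext i
  fin_cases i <;> simp [tube] <;> field_simp <;> grind

end ToroidalSurface

/-! ### Differentiation under the integral, and linearization of the energy integrand. -/

namespace ToroidalSurface

open MeasureTheory Filter Topology Set

theorem intervalIntegral_intervalIntegral_eq_setIntegral {g : ℝ × ℝ → ℝ} (hg : Continuous g)
    {b d : ℝ} (hb : 0 ≤ b) (hd : 0 ≤ d) :
    ∫ u in (0 : ℝ)..b, ∫ v in (0 : ℝ)..d, g (u, v) =
      ∫ q in Ioc 0 b ×ˢ Ioc 0 d, g q := by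
  rw [Measure.volume_eq_prod, setIntegral_prod, intervalIntegral.integral_of_le hb]
  · simp only [intervalIntegral.integral_of_le hd]
  · exact (hg.continuousOn.integrableOn_compact (isCompact_Icc.prod isCompact_Icc)).mono_set
      (prod_mono Ioc_subset_Icc_self Ioc_subset_Icc_self)

/-- Differentiation under a double integral. -/
theorem hasDerivAt_intervalIntegral_intervalIntegral {f : ℝ × ℝ × ℝ → ℝ} {f' : ℝ × ℝ → ℝ}
    {δ : ℝ} (hδ : 0 < δ) (hf : ∀ t u v, |t| < δ → ContDiffAt ℝ 1 f (t, u, v))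
    (hf' : ∀ u v, HasDerivAt (fun t => f (t, u, v)) (f' (u, v)) 0)
    {b d : ℝ} (hb : 0 ≤ b) (hd : 0 ≤ d) :
    HasDerivAt (fun t => ∫ u in (0 : ℝ)..b, ∫ v in (0 : ℝ)..d, f (t, u, v))
      (∫ u in (0 : ℝ)..b, ∫ v in (0 : ℝ)..d, f' (u, v)) 0 := by
  set D : ℝ → ℝ × ℝ → ℝ := fun t q => fderiv ℝ f (t, q) (1, 0) with hD
  have hderiv : ∀ t q, |t| < δ → HasDerivAt (fun t => f (t, q)) (D t q) t := by
    intro t q ht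
    have h1 := ((hf t q.1 q.2 ht).differentiableAt one_ne_zero).hasFDerivAt
    exact h1.comp_hasDerivAt t ((hasDerivAt_id t).prodMk (hasDerivAt_const t q))
  have hf'D : f' = D 0 := by
    funext q
    exact (hf' q.1 q.2).unique (hderiv 0 q (by simpa using hδ))
  have hcont : ∀ t, |t| < δ → Continuous fun q : ℝ × ℝ => f (t, q) := by
    intro t ht
    rw [continuous_iff_continuousAt]
    intro q
    exact ((hf t q.1 q.2 ht).continuousAt).comp (f := fun q : ℝ × ℝ => (t, q))
      (by fun_prop)
  have hDcont : ∀ t q, |t| < δ → ContinuousAt (fun z : ℝ × ℝ × ℝ => D z.1 z.2) (t, q) := by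
    intro t q ht
    have h1 : ContinuousAt (fderiv ℝ f) (t, q) :=
      ((hf t q.1 q.2 ht).fderiv_right (m := 0) (by simp)).continuousAt
    exact h1.clm_apply continuousAt_const
  have hD0 : Continuous (D 0) := by
    rw [continuous_iff_continuousAt]
    intro q
    exact (hDcont 0 q (by simpa using hδ)).comp (f := fun q : ℝ × ℝ => ((0 : ℝ), q))
      (by fun_prop)
  -- The dominating function is a constant: the `t`-derivative is continuous on a compact box.
  -- Halving `δ` keeps the closed ball inside the region of smoothness.
  obtain ⟨B, hB⟩ := ((isCompact_closedBall (0 : ℝ) (δ / 2)).prod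
    ((isCompact_Icc (a := (0 : ℝ)) (b := b)).prod
      (isCompact_Icc (a := (0 : ℝ)) (b := d)))).exists_bound_of_continuousOn
    (f := fun z : ℝ × ℝ × ℝ => D z.1 z.2) (by
      intro z hz
      refine (hDcont z.1 z.2 ?_).continuousWithinAt
      have := hz.1
      rw [mem_closedBall_zero_iff, Real.norm_eq_abs] at this
      linarith)
  have hball : ∀ t ∈ Metric.ball (0 : ℝ) (δ / 2), |t| < δ := by
    intro t ht
    rw [mem_ball_zero_iff, Real.norm_eq_abs] at ht
    linarith
  have hnhds : Metric.ball (0 : ℝ) (δ / 2) ∈ 𝓝 (0 : ℝ) := Metric.ball_mem_nhds _ (by linarith)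
  have hfin : volume (Ioc (0 : ℝ) b ×ˢ Ioc (0 : ℝ) d) ≠ ⊤ :=
    ((Metric.isBounded_Ioc _ _).prod (Metric.isBounded_Ioc _ _)).measure_lt_top.ne
  have key := (hasDerivAt_integral_of_dominated_loc_of_deriv_le
    (μ := volume.restrict (Ioc (0 : ℝ) b ×ˢ Ioc (0 : ℝ) d)) (F := fun t q => f (t, q)) (F' := D)
    (bound := fun _ => B) hnhds ?_ ?_ ?_ ?_ ?_ ?_).2
  · rw [hf'D, intervalIntegral_intervalIntegral_eq_setIntegral hD0 hb hd]
    refine key.congr_of_eventuallyEq ?_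
    filter_upwards [hnhds] with t ht
    exact intervalIntegral_intervalIntegral_eq_setIntegral (hcont t (hball t ht)) hb hd
  · filter_upwards [hnhds] with t ht
    exact (hcont t (hball t ht)).aestronglyMeasurable
  · exact ((hcont 0 (by simpa using hδ)).continuousOn.integrableOn_compact
      (isCompact_Icc.prod isCompact_Icc)).mono_set
      (prod_mono Ioc_subset_Icc_self Ioc_subset_Icc_self)
  · exact hD0.aestronglyMeasurable
  · filter_upwards [ae_restrict_mem (measurableSet_Ioc.prod measurableSet_Ioc)] with q hq t ht
    exact hB (t, q) ⟨Metric.ball_subset_closedBall ht, Ioc_subset_Icc_self hq.1,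
      Ioc_subset_Icc_self hq.2⟩
  · exact integrableOn_const hfin
  · exact Eventually.of_forall fun q t ht => hderiv t q (hball t ht)

theorem exists_partial_fst {F : ℝ × ℝ → ℝ} (hF : ContDiff ℝ ∞ F) :
    ∃ F' : ℝ × ℝ → ℝ, ContDiff ℝ ∞ F' ∧
      ∀ u v, HasDerivAt (fun s => F (s, v)) (F' (u, v)) u := by
  refine ⟨fun q => fderiv ℝ F q (1, 0), ?_, fun u v => ?_⟩
  · exact (hF.fderiv_right (m := ∞) (by simp)).clm_apply contDiff_const
  · exact ((hF.differentiable (by simp)) (u, v)).hasFDerivAt.comp_hasDerivAt u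
      ((hasDerivAt_id u).prodMk (hasDerivAt_const u v))

theorem exists_partial_snd {F : ℝ × ℝ → ℝ} (hF : ContDiff ℝ ∞ F) :
    ∃ F' : ℝ × ℝ → ℝ, ContDiff ℝ ∞ F' ∧
      ∀ u v, HasDerivAt (fun s => F (u, s)) (F' (u, v)) v := by
  refine ⟨fun q => fderiv ℝ F q (0, 1), ?_, fun u v => ?_⟩
  · exact (hF.fderiv_right (m := ∞) (by simp)).clm_apply contDiff_const
  · exact ((hF.differentiable (by simp)) (u, v)).hasFDerivAt.comp_hasDerivAt v
      ((hasDerivAt_const v u).prodMk (hasDerivAt_id v))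

theorem exists_bound_of_periodic {Ω : ℝ → ℝ → ℝ} (hc : Continuous fun q : ℝ × ℝ => Ω q.1 q.2)
    (hu : ∀ u v, Ω (u + 2 * Real.pi) v = Ω u v) (hv : ∀ u v, Ω u (v + 2 * Real.pi) = Ω u v) :
    ∃ B, ∀ u v, |Ω u v| ≤ B := by
  obtain ⟨B, hB⟩ := ((isCompact_Icc (a := (0 : ℝ)) (b := 2 * Real.pi)).prod
    (isCompact_Icc (a := (0 : ℝ)) (b := 2 * Real.pi))).exists_bound_of_continuousOn
    hc.continuousOn
  refine ⟨B, fun u v => ?_⟩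
  obtain ⟨u', hu', h1⟩ := Function.Periodic.exists_mem_Ico₀ (f := fun u => Ω u v)
    (fun u => hu u v) Real.two_pi_pos u
  obtain ⟨v', hv', h2⟩ := Function.Periodic.exists_mem_Ico₀ (f := fun v => Ω u' v)
    (fun v => hv u' v) Real.two_pi_pos v
  rw [show Ω u v = Ω u' v' from h1.trans h2]
  exact hB (u', v') ⟨Ico_subset_Icc_self hu', Ico_subset_Icc_self hv'⟩

theorem integral_deriv_periodic_eq_zero {f f' : ℝ → ℝ} (hf : ∀ x, HasDerivAt f (f' x) x)
    (hf' : Continuous f') {T : ℝ} (hT : f T = f 0) : ∫ x in (0 : ℝ)..T, f' x = 0 := by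
  rw [intervalIntegral.integral_eq_sub_of_hasDerivAt (fun x _ => hf x)
    (hf'.intervalIntegrable _ _), hT, sub_self]

section

variable {a r c s Ω Ωu Ωv Ωuu Ωuv Ωvv : ℝ}

/-- The derivatives of the radius enter only through squares, so they drop out at first order. -/
theorem hasDerivAt_tubeAreaSq :
    HasDerivAt (fun t => tubeAreaSq a c (r - t * Ω) (-(t * Ωu)) (-(t * Ωv)))
      (-(2 * r * (a + r * c) * (a + r * c + r * c) * Ω)) 0 := by
  have l (x : ℝ) : HasDerivAt (fun t : ℝ => t * x) x 0 := by
    simpa using (hasDerivAt_id (0 : ℝ)).mul_const x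
  have hρ := (l Ω).const_sub r
  have hw := (hρ.mul_const c).const_add a
  refine (((((l Ωu).neg.pow 2).mul (hw.pow 2)).add ((hρ.pow 2).mul ((l Ωv).neg.pow 2))).add
    ((hρ.pow 2).mul (hw.pow 2))).congr_deriv ?_
  simp
  ring

theorem hasDerivAt_tubeCurvNum :
    HasDerivAt (fun t => tubeCurvNum a c s (r - t * Ω) (-(t * Ωu)) (-(t * Ωv)) (-(t * Ωuu))
        (-(t * Ωuv)) (-(t * Ωvv)))
      (r * (a + r * c) ^ 3 * Ωuu - r ^ 2 * (a + r * c) ^ 2 * s * Ωu +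
        r ^ 3 * (a + r * c) * Ωvv - Ω * (2 * r * (a + r * c) ^ 3 + 3 * r ^ 2 * c * (a + r * c) ^ 2
          + 3 * r ^ 2 * (a + r * c) ^ 2 * c + 2 * r ^ 3 * (a + r * c) * c ^ 2)) 0 := by
  have l (x : ℝ) : HasDerivAt (fun t : ℝ => t * x) x 0 := by
    simpa using (hasDerivAt_id (0 : ℝ)).mul_const x
  have hρ := (l Ω).const_sub r
  have hw := (hρ.mul_const c).const_add a
  have hu := (l Ωu).neg
  have hv := (l Ωv).neg
  have huu := (l Ωuu).neg
  have huv := (l Ωuv).neg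
  have hvv := (l Ωvv).neg
  refine (((((hv.pow 2).add (hw.pow 2)).mul ((((hu.pow 2).const_mul 2).mul hw).sub
    (((huu.sub hρ).mul hρ).mul hw))).sub (((hu.mul hv).const_mul 2).mul
      ((((hv.mul hu).mul hw).add ((((hu.mul_const c).sub (hρ.mul_const s)).mul hρ).mul hv)).sub
        ((huv.mul hρ).mul hw)))).add (((hu.pow 2).add (hρ.pow 2)).mul
      (((((hw.pow 2).mul_const s).mul hu).add ((((hv.pow 2).const_mul 2).mul_const c).mul hρ)).sub
        (((hvv.sub (hw.mul_const c)).mul hρ).mul hw)))).congr_deriv ?_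
  simp
  ring

/-- The first variation of the energy integrand along a normal variation of the torus. -/
theorem hasDerivAt_energyDensity (E : Polynomial ℝ) (hr : 0 < r) (hw : 0 < a + r * c) :
    HasDerivAt (fun t => E.eval (tubeCurvNum a c s (r - t * Ω) (-(t * Ωu)) (-(t * Ωv))
          (-(t * Ωuu)) (-(t * Ωuv)) (-(t * Ωvv)) /
        (2 * (tubeAreaSq a c (r - t * Ω) (-(t * Ωu)) (-(t * Ωv)) *
          √(tubeAreaSq a c (r - t * Ω) (-(t * Ωu)) (-(t * Ωv)))))) *
        √(tubeAreaSq a c (r - t * Ω) (-(t * Ωu)) (-(t * Ωv))))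
      (E.derivative.eval ((a + 2 * r * c) / (2 * r * (a + r * c))) *
          ((a + r * c) / (2 * r) * Ωuu - s / 2 * Ωu + r / (2 * (a + r * c)) * Ωvv +
            ((a + r * c) / (2 * r) + r * c ^ 2 / (2 * (a + r * c))) * Ω) -
        E.eval ((a + 2 * r * c) / (2 * r * (a + r * c))) * (a + 2 * r * c) * Ω) 0 := by
  have hA := hasDerivAt_tubeAreaSq (a := a) (r := r) (c := c) (Ω := Ω) (Ωu := Ωu) (Ωv := Ωv)
  have hP := hasDerivAt_tubeCurvNum (a := a) (r := r) (c := c) (s := s) (Ω := Ω) (Ωu := Ωu)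
    (Ωv := Ωv) (Ωuu := Ωuu) (Ωuv := Ωuv) (Ωvv := Ωvv)
  have hA0 : tubeAreaSq a c (r - 0 * Ω) (-(0 * Ωu)) (-(0 * Ωv)) = (r * (a + r * c)) ^ 2 := by
    simp [tubeAreaSq]; ring
  have hP0 : tubeCurvNum a c s (r - 0 * Ω) (-(0 * Ωu)) (-(0 * Ωv)) (-(0 * Ωuu)) (-(0 * Ωuv))
      (-(0 * Ωvv)) = r ^ 2 * (a + r * c) ^ 2 * (a + 2 * r * c) := by
    simp [tubeCurvNum]; ring
  have hS0 : √(tubeAreaSq a c (r - 0 * Ω) (-(0 * Ωu)) (-(0 * Ωv))) = r * (a + r * c) := by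
    rw [hA0, Real.sqrt_sq (by positivity)]
  have hS := hA.sqrt (by rw [hA0]; positivity)
  have hH := hP.div ((hA.mul hS).const_mul 2) (by
    simp only [Pi.mul_apply]; rw [hS0, hA0]; positivity)
  refine (((E.hasDerivAt _).comp (0 : ℝ) hH).mul hS).congr_deriv ?_
  simp only [Function.comp_apply, Pi.mul_apply, Pi.div_apply]
  rw [hS0, hA0, hP0]
  have e1 : r ^ 2 * (a + r * c) ^ 2 * (a + 2 * r * c) /
      (2 * ((r * (a + r * c)) ^ 2 * (r * (a + r * c)))) =
      (a + 2 * r * c) / (2 * r * (a + r * c)) := by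
    field_simp
  rw [e1]
  field_simp
  ring

end

end ToroidalSurface

/-! ### Toroidal coordinates and the region enclosed by a tube. -/

namespace ToroidalSurface

open MeasureTheory Filter Topology Set

/-- Toroidal coordinates around the circle of radius `a`. -/
def toroidal (a s u v : ℝ) : E3 :=
  !₂[(a + s * Real.cos u) * Real.cos v, (a + s * Real.cos u) * Real.sin v, s * Real.sin u]

theorem tube_apply (a : ℝ) (ρ : ℝ → ℝ → ℝ) (u v : ℝ) : tube a ρ u v = toroidal a (ρ u v) u v := rfl

theorem continuous_toroidal (a : ℝ) :
    Continuous fun z : ℝ × ℝ × ℝ => toroidal a z.1 z.2.1 z.2.2 := by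
  unfold toroidal
  refine (PiLp.continuous_toLp 2 _).comp (continuous_pi fun i => ?_)
  fin_cases i <;> simp <;> fun_prop

/-- The solid tube `{s < ρ}`. -/
def solidTube (a : ℝ) (ρ : ℝ → ℝ → ℝ) : Set E3 :=
  {x | ∃ s u v, 0 ≤ s ∧ s < ρ u v ∧ x = toroidal a s u v}

theorem exists_polar (x y : ℝ) : ∃ R θ : ℝ, 0 ≤ R ∧ x = R * Real.cos θ ∧ y = R * Real.sin θ := by
  refine ⟨‖(⟨x, y⟩ : ℂ)‖, Complex.arg ⟨x, y⟩, norm_nonneg _, ?_, ?_⟩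
  · rw [Complex.norm_mul_cos_arg]
  · rw [Complex.norm_mul_sin_arg]

theorem eq_and_cos_eq_and_sin_eq_of_polar_eq {R R' θ θ' : ℝ} (hR : 0 ≤ R) (hR' : 0 ≤ R')
    (hc : R * Real.cos θ = R' * Real.cos θ') (hs : R * Real.sin θ = R' * Real.sin θ') :
    R = R' ∧ (0 < R → Real.cos θ = Real.cos θ' ∧ Real.sin θ = Real.sin θ') := by
  have h : R = R' := by
    rw [← sq_eq_sq₀ hR hR']
    have h1 := Real.sin_sq_add_cos_sq θ
    have h2 := Real.sin_sq_add_cos_sq θ'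
    calc R ^ 2 = (R * Real.cos θ) ^ 2 + (R * Real.sin θ) ^ 2 := by linear_combination -R ^ 2 * h1
      _ = R' ^ 2 := by rw [hc, hs]; linear_combination R' ^ 2 * h2
  refine ⟨h, fun h0 => ?_⟩
  subst h
  exact ⟨mul_left_cancel₀ h0.ne' hc, mul_left_cancel₀ h0.ne' hs⟩

theorem periodic_eq_of_cos_eq_of_sin_eq {α : Type*} {f : ℝ → α}
    (hf : Function.Periodic f (2 * Real.pi)) {x y : ℝ} (hc : Real.cos x = Real.cos y)
    (hs : Real.sin x = Real.sin y) : f x = f y := by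
  obtain ⟨k, hk⟩ := Real.Angle.angle_eq_iff_two_pi_dvd_sub.1 (Real.Angle.cos_sin_inj hc hs)
  rw [show x = y + k * (2 * Real.pi) by linarith, hf.int_mul k y]

theorem exists_toroidal (a : ℝ) (x : E3) :
    ∃ s u v, 0 ≤ s ∧ 0 ≤ a + s * Real.cos u ∧ x = toroidal a s u v := by
  obtain ⟨R, v, hR, h0, h1⟩ := exists_polar (x 0) (x 1)
  obtain ⟨s, u, hs, h2, h3⟩ := exists_polar (R - a) (x 2)
  refine ⟨s, u, v, hs, by rw [← h2]; linarith, ?_⟩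
  ext i
  fin_cases i <;> simp [toroidal, ← h2, ← h3, h0, h1]

section

variable {a : ℝ} {ρ : ℝ → ℝ → ℝ}

/-- Polar coordinates are compared twice, in the horizontal plane and in the meridian half-plane.
Angles are determined only modulo `2π`, and `u` not at all on the core circle `s = 0`, so the
conclusion concerns `ρ`, which is all that is needed later. -/
theorem toroidal_injective
    (hpu : ∀ u v, ρ (u + 2 * Real.pi) v = ρ u v) (hpv : ∀ u v, ρ u (v + 2 * Real.pi) = ρ u v)
    {s u v s' u' v' : ℝ} (hs : 0 ≤ s) (hs' : 0 ≤ s')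
    (hw : 0 ≤ a + s * Real.cos u) (hw' : 0 < a + s' * Real.cos u')
    (h : toroidal a s u v = toroidal a s' u' v') :
    s = s' ∧ (0 < s → ρ u v = ρ u' v') := by
  have h0 := congrArg (fun x : E3 => x 0) h
  have h1 := congrArg (fun x : E3 => x 1) h
  have h2 := congrArg (fun x : E3 => x 2) h
  simp only [toroidal, PiLp.toLp_apply, Matrix.cons_val] at h0 h1 h2
  obtain ⟨e, hv⟩ := eq_and_cos_eq_and_sin_eq_of_polar_eq hw hw'.le h0 h1
  obtain ⟨hcv, hsv⟩ := hv (e ▸ hw')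
  obtain ⟨e', hu⟩ := eq_and_cos_eq_and_sin_eq_of_polar_eq hs hs' (by linarith) h2
  refine ⟨e', fun h0 => ?_⟩
  obtain ⟨hcu, hsu⟩ := hu h0
  rw [periodic_eq_of_cos_eq_of_sin_eq (f := fun u => ρ u v) (fun u => hpu u v) hcu hsu,
    periodic_eq_of_cos_eq_of_sin_eq (f := fun v => ρ u' v) (fun v => hpv u' v) hcv hsv]

theorem toroidal_periodic {a s u v u' v' : ℝ} (hcu : Real.cos u = Real.cos u')
    (hsu : Real.sin u = Real.sin u') (hcv : Real.cos v = Real.cos v')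
    (hsv : Real.sin v = Real.sin v') : toroidal a s u v = toroidal a s u' v' := by
  rw [toroidal, hcu, hsu, hcv, hsv]; rfl

theorem exists_angles_mem_Icc
    (hpu : ∀ u v, ρ (u + 2 * Real.pi) v = ρ u v) (hpv : ∀ u v, ρ u (v + 2 * Real.pi) = ρ u v)
    (u v : ℝ) :
    ∃ u' ∈ Icc 0 (2 * Real.pi), ∃ v' ∈ Icc 0 (2 * Real.pi), ρ u v = ρ u' v' ∧
      ∀ s, toroidal a s u v = toroidal a s u' v' := by
  obtain ⟨u', hu', h1⟩ := Function.Periodic.exists_mem_Ico₀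
    (f := fun u => (Real.cos u, Real.sin u)) (fun u => by simp) Real.two_pi_pos u
  obtain ⟨v', hv', h2⟩ := Function.Periodic.exists_mem_Ico₀
    (f := fun u => (Real.cos u, Real.sin u)) (fun u => by simp) Real.two_pi_pos v
  simp only [Prod.mk.injEq] at h1 h2
  refine ⟨u', Ico_subset_Icc_self hu', v', Ico_subset_Icc_self hv', ?_, fun s => ?_⟩
  · rw [periodic_eq_of_cos_eq_of_sin_eq (f := fun u => ρ u v) (fun u => hpu u v) h1.1 h1.2,
      periodic_eq_of_cos_eq_of_sin_eq (f := fun v => ρ u' v) (fun v => hpv u' v) h2.1 h2.2]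
  · exact toroidal_periodic h1.1 h1.2 h2.1 h2.2

theorem add_mul_cos_pos {a s : ℝ} (hs : 0 ≤ s) (hsa : s < a) (u : ℝ) :
    0 < a + s * Real.cos u := by
  nlinarith [Real.neg_one_le_cos u]

theorem add_mul_cos_nonneg {a s : ℝ} (hs : 0 ≤ s) (hsa : s ≤ a) (u : ℝ) :
    0 ≤ a + s * Real.cos u := by
  nlinarith [Real.neg_one_le_cos u]

theorem isCompact_solidTube_union_surface
    (hpu : ∀ u v, ρ (u + 2 * Real.pi) v = ρ u v) (hpv : ∀ u v, ρ u (v + 2 * Real.pi) = ρ u v)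
    (hc : Continuous fun q : ℝ × ℝ => ρ q.1 q.2) (h0 : ∀ u v, 0 < ρ u v) :
    IsCompact (solidTube a ρ ∪ surface (tube a ρ)) := by
  have hK : IsCompact ((fun z : ℝ × ℝ × ℝ => toroidal a (z.1 * ρ z.2.1 z.2.2) z.2.1 z.2.2) ''
      (Icc 0 1 ×ˢ Icc 0 (2 * Real.pi) ×ˢ Icc 0 (2 * Real.pi))) := by
    refine (isCompact_Icc.prod (isCompact_Icc.prod isCompact_Icc)).image ?_
    have hρ : Continuous fun z : ℝ × ℝ × ℝ => ρ z.2.1 z.2.2 := hc.comp continuous_snd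
    exact (continuous_toroidal a).comp
      (f := fun z : ℝ × ℝ × ℝ => (z.1 * ρ z.2.1 z.2.2, z.2.1, z.2.2)) (by fun_prop)
  convert hK using 1
  ext x
  constructor
  · intro hx
    obtain ⟨s, u, v, hs, hsρ, rfl⟩ :
        ∃ s u v, 0 ≤ s ∧ s ≤ ρ u v ∧ x = toroidal a s u v := by
      rcases hx with ⟨s, u, v, hs, hsρ, rfl⟩ | ⟨q, rfl⟩
      · exact ⟨s, u, v, hs, hsρ.le, rfl⟩
      · exact ⟨ρ q.1 q.2, q.1, q.2, (h0 _ _).le, le_rfl, rfl⟩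
    obtain ⟨u', hu', v', hv', e, ht⟩ := exists_angles_mem_Icc (a := a) hpu hpv u v
    refine ⟨(s / ρ u v, u', v'), ⟨⟨div_nonneg hs (h0 _ _).le, ?_⟩, hu', hv'⟩, ?_⟩
    · exact (div_le_one (h0 _ _)).2 hsρ
    · simp only
      rw [← e, div_mul_cancel₀ _ (h0 _ _).ne', ht]
  · rintro ⟨⟨l, u, v⟩, ⟨hl, -, -⟩, rfl⟩
    obtain hl1 | hl1 := hl.2.eq_or_lt
    · right
      simp only at hl1
      exact ⟨(u, v), by simp [hl1, tube_apply]⟩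
    · left
      exact ⟨l * ρ u v, u, v, mul_nonneg hl.1 (h0 _ _).le,
        mul_lt_of_lt_one_left (h0 _ _) hl1, rfl⟩

/-- The solid is the open set of points at distance less than `a` from the core circle, minus the
compact shell `ρ ≤ s ≤ a`. This avoids inverting the coordinates, which degenerate on the core
circle. -/
theorem isOpen_solidTube
    (hpu : ∀ u v, ρ (u + 2 * Real.pi) v = ρ u v) (hpv : ∀ u v, ρ u (v + 2 * Real.pi) = ρ u v)
    (hc : Continuous fun q : ℝ × ℝ => ρ q.1 q.2) (h0 : ∀ u v, 0 < ρ u v) (h1 : ∀ u v, ρ u v < a) :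
    IsOpen (solidTube a ρ) := by
  have hK : IsCompact ((fun z : ℝ × ℝ × ℝ =>
      toroidal a (ρ z.2.1 z.2.2 + z.1 * (a - ρ z.2.1 z.2.2)) z.2.1 z.2.2) ''
      (Icc 0 1 ×ˢ Icc 0 (2 * Real.pi) ×ˢ Icc 0 (2 * Real.pi))) := by
    refine (isCompact_Icc.prod (isCompact_Icc.prod isCompact_Icc)).image ?_
    have hρ : Continuous fun z : ℝ × ℝ × ℝ => ρ z.2.1 z.2.2 := hc.comp continuous_snd
    exact (continuous_toroidal a).comp
      (f := fun z : ℝ × ℝ × ℝ => (ρ z.2.1 z.2.2 + z.1 * (a - ρ z.2.1 z.2.2), z.2.1, z.2.2))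
      (by fun_prop)
  have hD : IsOpen {x : E3 | (√(x 0 ^ 2 + x 1 ^ 2) - a) ^ 2 + x 2 ^ 2 < a ^ 2} :=
    isOpen_lt (by fun_prop) continuous_const
  have hdist : ∀ s u v, 0 ≤ a + s * Real.cos u →
      (√(toroidal a s u v 0 ^ 2 + toroidal a s u v 1 ^ 2) - a) ^ 2 + toroidal a s u v 2 ^ 2 =
        s ^ 2 := by
    intro s u v hw
    have e : toroidal a s u v 0 ^ 2 + toroidal a s u v 1 ^ 2 = (a + s * Real.cos u) ^ 2 := by
      simp only [toroidal, PiLp.toLp_apply, Matrix.cons_val]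
      linear_combination (a + s * Real.cos u) ^ 2 * Real.sin_sq_add_cos_sq v
    rw [e, Real.sqrt_sq hw]
    simp only [toroidal, PiLp.toLp_apply, Matrix.cons_val]
    linear_combination s ^ 2 * Real.sin_sq_add_cos_sq u
  convert hD.sdiff hK.isClosed using 1
  ext x
  constructor
  · rintro ⟨s, u, v, hs, hsρ, rfl⟩
    have hsa := hsρ.trans (h1 u v)
    refine ⟨?_, ?_⟩
    · rw [mem_ofPred_eq, hdist s u v (add_mul_cos_nonneg hs hsa.le u)]
      exact pow_lt_pow_left₀ hsa hs two_ne_zero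
    · rintro ⟨⟨l, u', v'⟩, ⟨hl, -, -⟩, h⟩
      simp only at h hl
      have hs' : ρ u' v' ≤ ρ u' v' + l * (a - ρ u' v') := by
        nlinarith [h1 u' v', hl.1]
      have hsa' : ρ u' v' + l * (a - ρ u' v') ≤ a := by
        nlinarith [h1 u' v', hl.2]
      have hs0' := (h0 u' v').trans_le hs'
      obtain ⟨e, hρ⟩ := toroidal_injective hpu hpv hs0'.le hs
        (add_mul_cos_nonneg hs0'.le hsa' u') (add_mul_cos_pos hs hsa u) h
      have := hρ hs0'
      linarith
  · rintro ⟨hx, hxK⟩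
    obtain ⟨s, u, v, hs, hw, rfl⟩ := exists_toroidal a x
    rw [mem_ofPred_eq, hdist s u v hw] at hx
    have ha : 0 < a := (h0 u v).trans (h1 u v)
    have hsa : s < a := lt_of_pow_lt_pow_left₀ 2 ha.le hx
    refine ⟨s, u, v, hs, ?_, rfl⟩
    by_contra! hge
    refine hxK ?_
    obtain ⟨u', hu', v', hv', e, ht⟩ := exists_angles_mem_Icc (a := a) hpu hpv u v
    have hpos : 0 < a - ρ u v := by linarith [h1 u v]
    refine ⟨((s - ρ u v) / (a - ρ u v), u', v'),
      ⟨⟨div_nonneg (by linarith) hpos.le, (div_le_one hpos).2 (by linarith)⟩, hu', hv'⟩, ?_⟩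
    simp only
    rw [← e, div_mul_cancel₀ _ hpos.ne', ht]
    congr 1
    ring

theorem disjoint_solidTube_surface
    (hpu : ∀ u v, ρ (u + 2 * Real.pi) v = ρ u v) (hpv : ∀ u v, ρ u (v + 2 * Real.pi) = ρ u v)
    (h0 : ∀ u v, 0 < ρ u v) (h1 : ∀ u v, ρ u v < a) :
    Disjoint (solidTube a ρ) (surface (tube a ρ)) := by
  rw [Set.disjoint_left]
  rintro _ ⟨s, u, v, hs, hsρ, rfl⟩ ⟨q, hq⟩
  simp only [tube_apply] at hq
  have hsa := hsρ.trans (h1 u v)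
  obtain ⟨e, h⟩ := toroidal_injective hpu hpv (h0 _ _).le hs
    (add_mul_cos_nonneg (h0 _ _).le (h1 _ _).le _) (add_mul_cos_pos hs hsa u) hq
  have := h (h0 _ _)
  linarith

theorem toroidal_notMem_surface
    (hpu : ∀ u v, ρ (u + 2 * Real.pi) v = ρ u v) (hpv : ∀ u v, ρ u (v + 2 * Real.pi) = ρ u v)
    (h0 : ∀ u v, 0 < ρ u v) (h1 : ∀ u v, ρ u v < a)
    {s u v : ℝ} (hs : ρ u v < s) (hw : 0 ≤ a + s * Real.cos u) :
    toroidal a s u v ∉ surface (tube a ρ) := by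
  rintro ⟨q, hq⟩
  simp only [tube_apply] at hq
  have hs0 := (h0 u v).trans hs
  obtain ⟨e, h⟩ := toroidal_injective hpu hpv hs0.le (h0 _ _).le hw
    (add_mul_cos_pos (h0 _ _).le (h1 _ _) _) hq.symm
  have := h hs0
  linarith

theorem axis_notMem_surface
    (h0 : ∀ u v, 0 < ρ u v) (h1 : ∀ u v, ρ u v < a) (z : ℝ) :
    (!₂[0, 0, z] : E3) ∉ surface (tube a ρ) := by
  rintro ⟨q, hq⟩
  have e0 := congrArg (fun x : E3 => x 0) hq
  have e1 := congrArg (fun x : E3 => x 1) hq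
  simp only [tube, PiLp.toLp_apply, Matrix.cons_val] at e0 e1
  have hw := add_mul_cos_pos (h0 q.1 q.2).le (h1 q.1 q.2) q.1
  have hc := (mul_eq_zero.1 e0).resolve_left hw.ne'
  have hs := (mul_eq_zero.1 e1).resolve_left hw.ne'
  have := Real.sin_sq_add_cos_sq q.2
  rw [hc, hs] at this
  norm_num at this

theorem not_isBounded_of_forall_norm {S : Set E3} (h : ∀ C : ℝ, ∃ x ∈ S, C < ‖x‖) :
    ¬ Bornology.IsBounded S := by
  intro hS
  obtain ⟨C, hC⟩ := hS.exists_norm_le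
  obtain ⟨x, hx, hlt⟩ := h C
  exact absurd (hC x hx) (not_le.2 hlt)

/-- Every point outside the closed solid tube can be joined to infinity off the tube. -/
theorem not_isBounded_connectedComponentIn
    (hpu : ∀ u v, ρ (u + 2 * Real.pi) v = ρ u v) (hpv : ∀ u v, ρ u (v + 2 * Real.pi) = ρ u v)
    (h0 : ∀ u v, 0 < ρ u v) (h1 : ∀ u v, ρ u v < a)
    {s u v : ℝ} (hs : ρ u v < s)
    (hw : 0 ≤ a + s * Real.cos u) :
    ¬ Bornology.IsBounded
      (connectedComponentIn (surface (tube a ρ))ᶜ (toroidal a s u v)) := by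
  have hs0 := (h0 u v).trans hs
  have hcont : Continuous fun s => toroidal a s u v :=
    (continuous_toroidal a).comp (f := fun s => (s, u, v)) (by fun_prop)
  have hnorm : ∀ x : E3, ∀ i, |x i| ≤ ‖x‖ := fun x i => by
    simpa using PiLp.norm_apply_le x i
  -- If `cos u ≥ 0`, the ray from the core circle never goes past the axis and escapes to infinity
  -- itself.
  obtain hcos | hcos := le_or_gt 0 (Real.cos u)
  · have hsub : (fun s => toroidal a s u v) '' Ici s ⊆
        connectedComponentIn (surface (tube a ρ))ᶜ (toroidal a s u v) := by
      refine IsPreconnected.subset_connectedComponentIn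
        (isPreconnected_Ici.image _ hcont.continuousOn) ⟨s, self_mem_Ici, rfl⟩ ?_
      rintro _ ⟨s', hs', rfl⟩
      refine toroidal_notMem_surface hpu hpv h0 h1 (hs.trans_le hs') ?_
      have : s * Real.cos u ≤ s' * Real.cos u := mul_le_mul_of_nonneg_right hs' hcos
      linarith
    refine fun hb => not_isBounded_of_forall_norm (fun C => ?_) (hb.subset hsub)
    have ha : 0 < a := (h0 u v).trans (h1 u v)
    refine ⟨_, ⟨max s (|C| + 1), mem_Ici.2 (le_max_left _ _), rfl⟩, ?_⟩
    set s' := max s (|C| + 1) with hs'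
    have hs'C : |C| + 1 ≤ s' := le_max_right _ _
    have hs'0 : 0 ≤ s' := by linarith [abs_nonneg C]
    have : s' ≤ ‖toroidal a s' u v‖ := by
      rw [toroidal, norm_vec3]
      refine Real.le_sqrt_of_sq_le ?_
      have h1 := Real.sin_sq_add_cos_sq u
      have h2 := Real.sin_sq_add_cos_sq v
      have h3 : ((a + s' * Real.cos u) * Real.cos v) ^ 2 +
          ((a + s' * Real.cos u) * Real.sin v) ^ 2 + (s' * Real.sin u) ^ 2 =
          s' ^ 2 + a ^ 2 + 2 * a * s' * Real.cos u := by
        linear_combination (a + s' * Real.cos u) ^ 2 * h2 + s' ^ 2 * h1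
      rw [h3]
      have : 0 ≤ 2 * a * s' * Real.cos u := by positivity
      nlinarith [sq_nonneg a]
    linarith [le_abs_self C]
  -- Otherwise the ray meets the axis at `s = S`; the path follows it that far, then runs along the
  -- axis, which misses the surface.
  · set S := -a / Real.cos u with hS
    have hSc : S * Real.cos u = -a := div_mul_cancel₀ _ hcos.ne
    have hsS : s ≤ S := by
      rw [hS, le_div_iff_of_neg hcos]; linarith
    have hP : IsPreconnected ((fun s => toroidal a s u v) '' Icc s S ∪
        range fun z : ℝ => (!₂[0, 0, z] : E3)) := by
      refine IsPreconnected.union (!₂[0, 0, S * Real.sin u]) ⟨S, ⟨hsS, le_rfl⟩, ?_⟩ ⟨_, rfl⟩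
        (isPreconnected_Icc.image _ hcont.continuousOn) (isPreconnected_range ?_)
      · simp [toroidal, hSc]
      · refine (PiLp.continuous_toLp 2 _).comp (continuous_pi fun i => ?_)
        fin_cases i <;> simp <;> fun_prop
    have hsub := hP.subset_connectedComponentIn (F := (surface (tube a ρ))ᶜ)
      (x := toroidal a s u v) (Or.inl ⟨s, ⟨le_rfl, hsS⟩, rfl⟩) (by
        rintro _ (⟨s', hs', rfl⟩ | ⟨z, rfl⟩)
        · refine toroidal_notMem_surface hpu hpv h0 h1 (hs.trans_le hs'.1) ?_
          have : S * Real.cos u ≤ s' * Real.cos u :=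
            mul_le_mul_of_nonpos_right hs'.2 hcos.le
          linarith
        · exact axis_notMem_surface h0 h1 z)
    refine fun hb => not_isBounded_of_forall_norm (fun C => ?_) (hb.subset hsub)
    refine ⟨_, Or.inr ⟨|C| + 1, rfl⟩, ?_⟩
    have := hnorm (!₂[0, 0, |C| + 1]) 2
    simp only [Matrix.cons_val] at this
    linarith [le_abs_self C, le_abs_self (|C| + 1)]

/-- Outside points lie in unbounded components. A component starting inside stays inside, since the
complement of the surface is covered by two disjoint open sets, the solid and the complement of its
compact union with the surface. -/
theorem enclosedRegion_tube
    (hpu : ∀ u v, ρ (u + 2 * Real.pi) v = ρ u v) (hpv : ∀ u v, ρ u (v + 2 * Real.pi) = ρ u v)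
    (hc : Continuous fun q : ℝ × ℝ => ρ q.1 q.2) (h0 : ∀ u v, 0 < ρ u v) (h1 : ∀ u v, ρ u v < a) :
    enclosedRegion (surface (tube a ρ)) = solidTube a ρ := by
  have hcpt := isCompact_solidTube_union_surface (a := a) hpu hpv hc h0
  have hdisj := disjoint_solidTube_surface hpu hpv h0 h1
  ext x
  constructor
  · rintro ⟨hxS, hb⟩
    obtain ⟨s, u, v, hs, hw, rfl⟩ := exists_toroidal a x
    by_contra hx
    refine not_isBounded_connectedComponentIn hpu hpv h0 h1 (lt_of_le_of_ne ?_ ?_) hw hb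
    · by_contra! hlt
      exact hx ⟨s, u, v, hs, hlt, rfl⟩
    · rintro rfl
      exact hxS ⟨(u, v), rfl⟩
  · intro hx
    have hxS : x ∉ surface (tube a ρ) := Set.disjoint_left.1 hdisj hx
    refine ⟨hxS, (hcpt.isBounded.subset subset_union_left).subset ?_⟩
    refine isPreconnected_connectedComponentIn.subset_left_of_subset_union
      (isOpen_solidTube hpu hpv hc h0 h1) hcpt.isClosed.isOpen_compl ?_ ?_ ?_
    · exact disjoint_compl_right.mono_left subset_union_left
    · intro y hy
      have hyS := connectedComponentIn_subset _ _ hy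
      by_cases hyI : y ∈ solidTube a ρ
      · exact Or.inl hyI
      · exact Or.inr fun h => h.elim hyI hyS
    · exact ⟨x, mem_connectedComponentIn hxS, hx⟩

end

end ToroidalSurface

/-! ### Volume of the solid tube. -/

namespace ToroidalSurface

open MeasureTheory Filter Topology Set

theorem measurePreserving_vec3 :
    MeasurePreserving (fun q : ℝ × ℝ × ℝ => (!₂[q.2.1, q.2.2, q.1] : E3)) := by
  have h1 := (volume_preserving_piFinSuccAbove (fun _ : Fin 3 => ℝ) 2).symm
  have h2 := (MeasurePreserving.id (volume : Measure ℝ)).prod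
    (volume_preserving_finTwoArrow ℝ).symm
  rw [← Measure.volume_eq_prod, ← Measure.volume_eq_prod] at h2
  convert (PiLp.volume_preserving_toLp (Fin 3)).comp (h1.comp h2) using 1
  funext q
  ext i
  fin_cases i <;> rfl

theorem intervalIntegral_swap_of_continuous {g : ℝ × ℝ → ℝ} (hg : Continuous g)
    {b d : ℝ} (hb : 0 ≤ b) (hd : 0 ≤ d) :
    ∫ u in (0 : ℝ)..b, ∫ v in (0 : ℝ)..d, g (u, v) =
      ∫ v in (0 : ℝ)..d, ∫ u in (0 : ℝ)..b, g (u, v) := by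
  simp only [intervalIntegral.integral_of_le hb, intervalIntegral.integral_of_le hd]
  refine integral_integral_swap (f := fun u v => g (u, v)) ?_
  rw [Measure.prod_restrict, ← Measure.volume_eq_prod]
  exact (hg.continuousOn.integrableOn_compact (isCompact_Icc.prod isCompact_Icc)).mono_set
    (prod_mono Ioc_subset_Icc_self Ioc_subset_Icc_self)

theorem lintegral_ofReal_periodic {f : ℝ → ℝ} (hf : Continuous f) (h0 : ∀ x, 0 ≤ f x)
    (hp : Function.Periodic f (2 * Real.pi)) :
    ∫⁻ x in Ioo (-Real.pi) Real.pi, ENNReal.ofReal (f x) =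
      ENNReal.ofReal (∫ x in (0 : ℝ)..(2 * Real.pi), f x) := by
  have h1 := hp.intervalIntegral_add_eq (-Real.pi) 0
  rw [zero_add, show -Real.pi + 2 * Real.pi = Real.pi by ring] at h1
  rw [← h1, intervalIntegral.integral_of_le (by linarith [Real.pi_pos]),
    integral_Ioc_eq_integral_Ioo, ofReal_integral_eq_lintegral_ofReal]
  · exact (hf.continuousOn.integrableOn_compact isCompact_Icc).mono_set Ioo_subset_Icc_self
  · exact Eventually.of_forall h0

theorem lintegral_radial {a c R : ℝ} (hR : 0 ≤ R) (h : ∀ s ∈ Icc 0 R, 0 ≤ a + s * c) :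
    ∫⁻ s in Ioo 0 R, ENNReal.ofReal (s * (a + s * c)) =
      ENNReal.ofReal (a * R ^ 2 / 2 + c * R ^ 3 / 3) := by
  have hcont : Continuous fun s : ℝ => s * (a + s * c) := by fun_prop
  rw [← ofReal_integral_eq_lintegral_ofReal, ← integral_Ioc_eq_integral_Ioo,
    ← intervalIntegral.integral_of_le hR]
  · congr 1
    have hd : ∀ s : ℝ, HasDerivAt (fun s => a * s ^ 2 / 2 + c * s ^ 3 / 3) (s * (a + s * c)) s := by
      intro s
      refine ((((hasDerivAt_pow 2 s).const_mul a).div_const 2).add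
        (((hasDerivAt_pow 3 s).const_mul c).div_const 3)).congr_deriv ?_
      simp
      ring
    rw [intervalIntegral.integral_eq_sub_of_hasDerivAt (fun s _ => hd s)
      (hcont.intervalIntegrable _ _)]
    simp
  · exact (hcont.continuousOn.integrableOn_compact isCompact_Icc).mono_set Ioo_subset_Icc_self
  · filter_upwards [ae_restrict_mem measurableSet_Ioo] with s hs
    exact mul_nonneg hs.1.le (h s (Ioo_subset_Icc_self hs))

theorem lintegral_polar_iterated (f : ℝ × ℝ → ENNReal) (hf : Measurable f) :
    ∫⁻ p, f p = ∫⁻ θ in Ioo (-Real.pi) Real.pi, ∫⁻ R in Ioi (0 : ℝ),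
      ENNReal.ofReal R * f (R * Real.cos θ, R * Real.sin θ) := by
  have hm : Measurable fun p : ℝ × ℝ =>
      ENNReal.ofReal p.1 * f (p.1 * Real.cos p.2, p.1 * Real.sin p.2) := by fun_prop
  rw [← lintegral_comp_polarCoord_symm, polarCoord_target, Measure.volume_eq_prod,
    ← Measure.prod_restrict, lintegral_prod_symm]
  · simp [polarCoord]
  · simpa [polarCoord] using hm.aemeasurable

/-- Polar coordinates are applied first in the horizontal plane, then in the meridian plane about
`(a, 0)`. The Jacobian is `s (a + s cos u)`, whose integral over `0 < s < ρ` is the integrand shown.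
-/
theorem volume_solidTube {a : ℝ} {ρ : ℝ → ℝ → ℝ} (hpu : ∀ u v, ρ (u + 2 * Real.pi) v = ρ u v)
    (hpv : ∀ u v, ρ u (v + 2 * Real.pi) = ρ u v)
    (hc : Continuous fun q : ℝ × ℝ => ρ q.1 q.2) (h0 : ∀ u v, 0 < ρ u v)
    (h1 : ∀ u v, ρ u v < a) :
    volume (solidTube a ρ) = ENNReal.ofReal (∫ u in (0 : ℝ)..(2 * Real.pi),
      ∫ v in (0 : ℝ)..(2 * Real.pi), (a * ρ u v ^ 2 / 2 + Real.cos u * ρ u v ^ 3 / 3)) := by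
  have hI := (isOpen_solidTube hpu hpv hc h0 h1).measurableSet
  have hm : Measurable fun q : ℝ × ℝ × ℝ => (!₂[q.2.1, q.2.2, q.1] : E3) :=
    measurePreserving_vec3.measurable
  set g : ℝ × ℝ × ℝ → ENNReal :=
    fun q => (solidTube a ρ).indicator 1 (!₂[q.2.1, q.2.2, q.1] : E3) with hg
  have hgm : Measurable g := (measurable_one.indicator hI).comp hm
  have e1 : volume (solidTube a ρ) = ∫⁻ z, ∫⁻ p : ℝ × ℝ, g (z, p) := by
    rw [← lintegral_indicator_one hI,
      ← measurePreserving_vec3.lintegral_comp (measurable_one.indicator hI),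
      Measure.volume_eq_prod, lintegral_prod _ hgm.aemeasurable]
  -- The indicator of `R > 0` extends the integrand to the whole plane, so that translation by `(a,
  -- 0)` is available.
  set k : ℝ → ℝ × ℝ → ENNReal := fun v q => (Ioi 0).indicator
    (fun R => ENNReal.ofReal R * g (q.2, R * Real.cos v, R * Real.sin v)) q.1 with hk
  have hkm : Measurable (Function.uncurry k) := by
    have : Function.uncurry k = {z : ℝ × ℝ × ℝ | 0 < z.2.1}.indicator (fun z =>
        ENNReal.ofReal z.2.1 * g (z.2.2, z.2.1 * Real.cos z.1, z.2.1 * Real.sin z.1)) := by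
      funext z
      rfl
    rw [this]
    exact Measurable.indicator (by fun_prop) (measurableSet_lt (by fun_prop) (by fun_prop))
  have e2 : ∫⁻ z, ∫⁻ p : ℝ × ℝ, g (z, p) =
      ∫⁻ v in Ioo (-Real.pi) Real.pi, ∫⁻ q : ℝ × ℝ, k v q := by
    have : ∀ z, ∫⁻ p : ℝ × ℝ, g (z, p) =
        ∫⁻ v in Ioo (-Real.pi) Real.pi, ∫⁻ R, k v (R, z) := by
      intro z
      rw [lintegral_polar_iterated _ (by fun_prop)]
      refine lintegral_congr fun v => ?_
      rw [← lintegral_indicator measurableSet_Ioi]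
    simp_rw [this]
    rw [lintegral_lintegral_swap]
    · refine lintegral_congr fun v => ?_
      rw [Measure.volume_eq_prod, lintegral_prod_symm]
      exact (hkm.comp (measurable_const.prodMk measurable_id)).aemeasurable
    · refine Measurable.aemeasurable ?_
      exact Measurable.lintegral_prod_right' (f := fun x : (ℝ × ℝ) × ℝ => k x.1.2 (x.2, x.1.1))
        (hkm.comp (f := fun x : (ℝ × ℝ) × ℝ => (x.1.2, x.2, x.1.1)) (by fun_prop))
  have e3 : ∀ v, ∫⁻ q : ℝ × ℝ, k v q = ∫⁻ u in Ioo (-Real.pi) Real.pi,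
      ENNReal.ofReal (a * ρ u v ^ 2 / 2 + Real.cos u * ρ u v ^ 3 / 3) := by
    intro v
    have hkv : Measurable (k v) := hkm.comp (measurable_const.prodMk measurable_id)
    rw [← lintegral_add_left_eq_self (k v) ((a, 0) : ℝ × ℝ),
      lintegral_polar_iterated _ (by fun_prop)]
    refine lintegral_congr fun u => ?_
    rw [← lintegral_radial (h0 u v).le fun s hs =>
        add_mul_cos_nonneg hs.1 (hs.2.trans (h1 u v).le) u,
      ← lintegral_indicator measurableSet_Ioi, ← lintegral_indicator measurableSet_Ioo]
    refine lintegral_congr fun s => ?_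
    by_cases hs : 0 < s
    swap
    · rw [indicator_of_notMem (by simpa using hs), indicator_of_notMem (fun h => hs h.1)]
    rw [indicator_of_mem (mem_Ioi.2 hs)]
    have hvec : (!₂[(a + s * Real.cos u) * Real.cos v, (a + s * Real.cos u) * Real.sin v,
      0 + s * Real.sin u] : E3) = toroidal a s u v := by simp [toroidal]
    by_cases hsρ : s < ρ u v
    · have hw := add_mul_cos_pos hs.le (hsρ.trans (h1 u v)) u
      rw [indicator_of_mem (show s ∈ Ioo 0 (ρ u v) from ⟨hs, hsρ⟩)]
      simp only [hk, hg, Prod.mk_add_mk]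
      rw [indicator_of_mem (mem_Ioi.2 hw), hvec,
        indicator_of_mem (show toroidal a s u v ∈ solidTube a ρ from ⟨s, u, v, hs.le, hsρ, rfl⟩),
        Pi.one_apply, mul_one, ENNReal.ofReal_mul hs.le]
    · rw [indicator_of_notMem (fun h => hsρ h.2)]
      simp only [hk, hg, Prod.mk_add_mk]
      -- Beyond radius `ρ` the integrand vanishes either because the point is outside the solid or
      -- because the ray has reached the axis.
      by_cases hw : 0 < a + s * Real.cos u
      · rw [indicator_of_mem (mem_Ioi.2 hw), hvec, indicator_of_notMem, mul_zero, mul_zero]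
        rintro ⟨s', u', v', hs', hsρ', h⟩
        obtain ⟨e, h'⟩ := toroidal_injective hpu hpv hs.le hs' hw.le
          (add_mul_cos_pos hs' (hsρ'.trans (h1 _ _)) _) h
        have := h' hs
        linarith
      · rw [indicator_of_notMem (by simpa using hw), mul_zero]
  have hnn : ∀ u v, 0 ≤ a * ρ u v ^ 2 / 2 + Real.cos u * ρ u v ^ 3 / 3 := by
    intro u v
    have h3 : 0 ≤ ρ u v ^ 2 * (a + ρ u v * Real.cos u) :=
      mul_nonneg (sq_nonneg _) (add_mul_cos_nonneg (h0 u v).le (h1 u v).le u)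
    have h4 : 0 ≤ a * ρ u v ^ 2 := mul_nonneg ((h0 u v).trans (h1 u v)).le (sq_nonneg _)
    nlinarith
  have hVc : Continuous fun q : ℝ × ℝ =>
      a * ρ q.1 q.2 ^ 2 / 2 + Real.cos q.1 * ρ q.1 q.2 ^ 3 / 3 := by fun_prop
  rw [e1, e2, intervalIntegral_swap_of_continuous hVc Real.two_pi_pos.le Real.two_pi_pos.le]
  simp_rw [e3]
  have e4 : ∀ v, ∫⁻ u in Ioo (-Real.pi) Real.pi,
      ENNReal.ofReal (a * ρ u v ^ 2 / 2 + Real.cos u * ρ u v ^ 3 / 3) =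
      ENNReal.ofReal (∫ u in (0 : ℝ)..(2 * Real.pi),
        (a * ρ u v ^ 2 / 2 + Real.cos u * ρ u v ^ 3 / 3)) := fun v =>
    lintegral_ofReal_periodic
      (hVc.comp (f := fun u => (u, v)) (by fun_prop)) (fun u => hnn u v)
      (fun u => by simp only [hpu, Real.cos_add_two_pi])
  simp_rw [e4]
  refine lintegral_ofReal_periodic ?_ (fun v => ?_) (fun v => by simp only [hpv])
  · exact intervalIntegral.continuous_parametric_intervalIntegral_of_continuous'
      (f := fun v u => a * ρ u v ^ 2 / 2 + Real.cos u * ρ u v ^ 3 / 3)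
      (hVc.comp continuous_swap) _ _
  · exact intervalIntegral.integral_nonneg Real.two_pi_pos.le fun u _ => hnn u v

theorem enclosedVolume_tube {a : ℝ} {ρ : ℝ → ℝ → ℝ} (hpu : ∀ u v, ρ (u + 2 * Real.pi) v = ρ u v)
    (hpv : ∀ u v, ρ u (v + 2 * Real.pi) = ρ u v)
    (hc : Continuous fun q : ℝ × ℝ => ρ q.1 q.2) (h0 : ∀ u v, 0 < ρ u v)
    (h1 : ∀ u v, ρ u v < a) :
    enclosedVolume (surface (tube a ρ)) = ∫ u in (0 : ℝ)..(2 * Real.pi),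
      ∫ v in (0 : ℝ)..(2 * Real.pi), (a * ρ u v ^ 2 / 2 + Real.cos u * ρ u v ^ 3 / 3) := by
  rw [enclosedVolume, enclosedRegion_tube hpu hpv hc h0 h1,
    volume_solidTube hpu hpv hc h0 h1, ENNReal.toReal_ofReal]
  refine intervalIntegral.integral_nonneg Real.two_pi_pos.le fun u _ =>
    intervalIntegral.integral_nonneg Real.two_pi_pos.le fun v _ => ?_
  have h3 : 0 ≤ ρ u v ^ 2 * (a + ρ u v * Real.cos u) :=
    mul_nonneg (sq_nonneg _) (add_mul_cos_nonneg (h0 u v).le (h1 u v).le u)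
  have h4 : 0 ≤ a * ρ u v ^ 2 := mul_nonneg ((h0 u v).trans (h1 u v)).le (sq_nonneg _)
  nlinarith

end ToroidalSurface

/-! ### First variation of the energy and the Euler–Lagrange equation. -/

namespace ToroidalSurface

open MeasureTheory Filter Topology Set

/-- A periodic `Ω` is bounded, so for small `t` the varied surface is still an embedded tube to
which the area and volume formulas apply. -/
theorem exists_forall_abs_lt_radius_mem {a r : ℝ} (hr : 0 < r) (har : r < a) {Ω : ℝ → ℝ → ℝ}
    (hΩ : IsSmoothPeriodic Ω) :
    ∃ δ > 0, ∀ t, |t| < δ → ∀ u v, 0 < r - t * Ω u v ∧ r - t * Ω u v < a := by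
  obtain ⟨B, hB⟩ := exists_bound_of_periodic hΩ.1.continuous hΩ.2.1 hΩ.2.2
  have hB0 : 0 ≤ B := (abs_nonneg _).trans (hB 0 0)
  have hm : 0 < min r (a - r) := lt_min hr (by linarith)
  refine ⟨min r (a - r) / (B + 1), by positivity, fun t ht u v => ?_⟩
  rw [lt_div_iff₀ (by linarith)] at ht
  have h1 : |t * Ω u v| < min r (a - r) := by
    rw [abs_mul]
    refine lt_of_le_of_lt (mul_le_mul_of_nonneg_left ?_ (abs_nonneg t)) ht
    linarith [hB u v]
  have h2 := abs_lt.1 (h1.trans_le (min_le_left _ _))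
  have h3 := abs_lt.1 (h1.trans_le (min_le_right _ _))
  constructor <;> linarith

theorem intervalIntegral_intervalIntegral_add {g h : ℝ × ℝ → ℝ} (hg : Continuous g)
    (hh : Continuous h) {b d : ℝ} (hb : 0 ≤ b) (hd : 0 ≤ d) :
    ∫ u in (0 : ℝ)..b, ∫ v in (0 : ℝ)..d, (g (u, v) + h (u, v)) =
      (∫ u in (0 : ℝ)..b, ∫ v in (0 : ℝ)..d, g (u, v)) +
        ∫ u in (0 : ℝ)..b, ∫ v in (0 : ℝ)..d, h (u, v) := by
  have hi : ∀ {g : ℝ × ℝ → ℝ}, Continuous g → IntegrableOn g (Ioc 0 b ×ˢ Ioc 0 d) := fun hg =>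
    (hg.continuousOn.integrableOn_compact (isCompact_Icc.prod isCompact_Icc)).mono_set
      (prod_mono Ioc_subset_Icc_self Ioc_subset_Icc_self)
  rw [intervalIntegral_intervalIntegral_eq_setIntegral (g := fun q => g q + h q) (hg.add hh) hb hd,
    intervalIntegral_intervalIntegral_eq_setIntegral hg hb hd,
    intervalIntegral_intervalIntegral_eq_setIntegral hh hb hd]
  exact integral_add (hi hg) (hi hh)

theorem tubeAreaSq_pos {a c ρ ρu ρv : ℝ} (hρ : 0 < ρ) (hw : 0 < a + ρ * c) :
    0 < tubeAreaSq a c ρ ρu ρv := by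
  unfold tubeAreaSq
  positivity

theorem contDiff_polynomial_eval (E : Polynomial ℝ) : ContDiff ℝ ∞ fun x => E.eval x := by
  simpa using E.contDiff_aeval (𝕜 := ℝ) (n := ∞)

/-- The energy density as a polynomial in `1 / (a + r cos u)`. -/
def reducedEnergy (a r : ℝ) (E : Polynomial ℝ) : Polynomial ℝ :=
  E.comp (Polynomial.C (1 / r) - Polynomial.C (a / (2 * r)) * Polynomial.X)

theorem eval_reducedEnergy {a r c : ℝ} (E : Polynomial ℝ) (hr : r ≠ 0) (hw : a + r * c ≠ 0) :
    (reducedEnergy a r E).eval (a + r * c)⁻¹ =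
      E.eval ((a + 2 * r * c) / (2 * r * (a + r * c))) := by
  rw [reducedEnergy, Polynomial.eval_comp]
  congr 1
  simp
  field_simp
  ring

theorem eval_derivative_reducedEnergy {a r c : ℝ} (E : Polynomial ℝ) (ha : a ≠ 0) (hr : r ≠ 0)
    (hw : a + r * c ≠ 0) :
    (Polynomial.C (-(2 * r / a)) * (reducedEnergy a r E).derivative).eval (a + r * c)⁻¹ =
      E.derivative.eval ((a + 2 * r * c) / (2 * r * (a + r * c))) := by
  have h : (1 / r - a / (2 * r) * (a + r * c)⁻¹) = (a + 2 * r * c) / (2 * r * (a + r * c)) := by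
    field_simp
    ring
  rw [reducedEnergy, Polynomial.derivative_comp]
  simp only [Polynomial.derivative_sub, Polynomial.derivative_C, Polynomial.derivative_mul,
    Polynomial.derivative_X, Polynomial.eval_mul, Polynomial.eval_comp, Polynomial.eval_sub,
    Polynomial.eval_C, Polynomial.eval_X, Polynomial.eval_add, Polynomial.eval_zero,
    Polynomial.eval_one, h]
  field_simp
  ring

/-- `Fu, Fv, Fuu, Fuv, Fvv` are the partial derivatives of the smooth function `F`. -/
structure IsJet (F Fu Fv Fuu Fuv Fvv : ℝ × ℝ → ℝ) : Prop where
  smooth : ContDiff ℝ ∞ F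
  smooth_u : ContDiff ℝ ∞ Fu
  smooth_v : ContDiff ℝ ∞ Fv
  smooth_uu : ContDiff ℝ ∞ Fuu
  smooth_uv : ContDiff ℝ ∞ Fuv
  smooth_vv : ContDiff ℝ ∞ Fvv
  hasDerivAt_u : ∀ u v, HasDerivAt (fun s => F (s, v)) (Fu (u, v)) u
  hasDerivAt_v : ∀ u v, HasDerivAt (fun s => F (u, s)) (Fv (u, v)) v
  hasDerivAt_uu : ∀ u v, HasDerivAt (fun s => Fu (s, v)) (Fuu (u, v)) u
  hasDerivAt_uv : ∀ u v, HasDerivAt (fun s => Fu (u, s)) (Fuv (u, v)) v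
  hasDerivAt_vv : ∀ u v, HasDerivAt (fun s => Fv (u, s)) (Fvv (u, v)) v

theorem exists_isJet {F : ℝ × ℝ → ℝ} (hF : ContDiff ℝ ∞ F) :
    ∃ Fu Fv Fuu Fuv Fvv, IsJet F Fu Fv Fuu Fuv Fvv := by
  obtain ⟨Fu, hFu, du⟩ := exists_partial_fst hF
  obtain ⟨Fv, hFv, dv⟩ := exists_partial_snd hF
  obtain ⟨Fuu, hFuu, duu⟩ := exists_partial_fst hFu
  obtain ⟨Fuv, hFuv, duv⟩ := exists_partial_snd hFu
  obtain ⟨Fvv, hFvv, dvv⟩ := exists_partial_snd hFv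
  exact ⟨Fu, Fv, Fuu, Fuv, Fvv, hF, hFu, hFv, hFuu, hFuv, hFvv, du, dv, duu, duv, dvv⟩

section

variable {a r : ℝ} {F Fu Fv Fuu Fuv Fvv : ℝ × ℝ → ℝ}

/-- The first variation of the curvature energy integrand of the torus. -/
def energyVariation (a r : ℝ) (E : Polynomial ℝ) (F Fu Fuu Fvv : ℝ × ℝ → ℝ) (q : ℝ × ℝ) : ℝ :=
  (Polynomial.C (-(2 * r / a)) * (reducedEnergy a r E).derivative).eval
      (a + r * Real.cos q.1)⁻¹ *
    ((a + r * Real.cos q.1) / (2 * r) * Fuu q - Real.sin q.1 / 2 * Fu q +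
      r * (a + r * Real.cos q.1)⁻¹ / 2 * Fvv q +
      ((a + r * Real.cos q.1) / (2 * r) +
        r * Real.cos q.1 ^ 2 * (a + r * Real.cos q.1)⁻¹ / 2) * F q) -
    (reducedEnergy a r E).eval (a + r * Real.cos q.1)⁻¹ * (a + 2 * r * Real.cos q.1) * F q

theorem hasDerivAt_integral_energy (hr : 0 < r) (har : r < a) (E : Polynomial ℝ)
    (hF : IsJet F Fu Fv Fuu Fuv Fvv) {δ : ℝ} (hδ : 0 < δ)
    (hρ : ∀ t, |t| < δ → ∀ q, 0 < r - t * F q ∧ r - t * F q < a) :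
    HasDerivAt (fun t => ∫ u in (0 : ℝ)..(2 * Real.pi), ∫ v in (0 : ℝ)..(2 * Real.pi),
        E.eval (meanCurvature (tube a fun u v => r - t * F (u, v)) u v) *
          areaDensity (tube a fun u v => r - t * F (u, v)) u v)
      (∫ u in (0 : ℝ)..(2 * Real.pi), ∫ v in (0 : ℝ)..(2 * Real.pi),
        energyVariation a r E F Fu Fuu Fvv (u, v)) 0 := by
  have h2π := Real.two_pi_pos.le
  obtain ⟨s0, su, sv, suu, suv, svv, du, dv, duu, duv, dvv⟩ := hF
  obtain ⟨f, hf⟩ : ∃ f : ℝ × ℝ × ℝ → ℝ, f =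
      fun z : ℝ × ℝ × ℝ => E.eval (tubeCurvNum a (Real.cos z.2.1) (Real.sin z.2.1)
        (r - z.1 * F z.2) (-(z.1 * Fu z.2)) (-(z.1 * Fv z.2)) (-(z.1 * Fuu z.2))
        (-(z.1 * Fuv z.2)) (-(z.1 * Fvv z.2)) /
        (2 * (tubeAreaSq a (Real.cos z.2.1) (r - z.1 * F z.2) (-(z.1 * Fu z.2))
          (-(z.1 * Fv z.2)) * √(tubeAreaSq a (Real.cos z.2.1) (r - z.1 * F z.2)
            (-(z.1 * Fu z.2)) (-(z.1 * Fv z.2)))))) *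
        √(tubeAreaSq a (Real.cos z.2.1) (r - z.1 * F z.2) (-(z.1 * Fu z.2))
          (-(z.1 * Fv z.2))) := ⟨_, rfl⟩
  have heq : ∀ t u v, E.eval (meanCurvature (tube a fun u v => r - t * F (u, v)) u v) *
      areaDensity (tube a fun u v => r - t * F (u, v)) u v = f (t, u, v) := by
    intro t u v
    have du' : ∀ u v, HasDerivAt (fun s => r - t * F (s, v))
        ((fun u v => -(t * Fu (u, v))) u v) u :=
      fun u v => ((du u v).const_mul t).const_sub r
    have dv' : ∀ u v, HasDerivAt (fun s => r - t * F (u, s))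
        ((fun u v => -(t * Fv (u, v))) u v) v :=
      fun u v => ((dv u v).const_mul t).const_sub r
    rw [areaDensity_tube (ρ := fun u v => r - t * F (u, v)) du' dv',
      meanCurvature_tube (ρ := fun u v => r - t * F (u, v))
        (ρuu := fun u v => -(t * Fuu (u, v))) (ρuv := fun u v => -(t * Fuv (u, v)))
        (ρvv := fun u v => -(t * Fvv (u, v))) du' dv'
        (fun u v => ((duu u v).const_mul t).neg) (fun u v => ((duv u v).const_mul t).neg)
        (fun u v => ((dvv u v).const_mul t).neg), hf]
  simp only [heq]
  refine hasDerivAt_intervalIntegral_intervalIntegral hδ (fun t u v ht => ?_) (fun u v => ?_)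
    h2π h2π <;> subst hf
  · have hA : ContDiff ℝ ∞ fun z : ℝ × ℝ × ℝ => tubeAreaSq a (Real.cos z.2.1) (r - z.1 * F z.2)
        (-(z.1 * Fu z.2)) (-(z.1 * Fv z.2)) := by
      simp only [tubeAreaSq]; fun_prop
    have hP : ContDiff ℝ ∞ fun z : ℝ × ℝ × ℝ => tubeCurvNum a (Real.cos z.2.1)
        (Real.sin z.2.1) (r - z.1 * F z.2) (-(z.1 * Fu z.2)) (-(z.1 * Fv z.2))
        (-(z.1 * Fuu z.2)) (-(z.1 * Fuv z.2)) (-(z.1 * Fvv z.2)) := by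
      simp only [tubeCurvNum]; fun_prop
    have hpos : 0 < tubeAreaSq a (Real.cos u) (r - t * F (u, v)) (-(t * Fu (u, v)))
        (-(t * Fv (u, v))) :=
      tubeAreaSq_pos (hρ t ht _).1 (add_mul_cos_pos (hρ t ht _).1.le (hρ t ht _).2 u)
    have hA1 := (hA.of_le (m := 1) (by simp)).contDiffAt (x := (t, u, v))
    have hS := hA1.sqrt hpos.ne'
    have hq := ((hP.of_le (m := 1) (by simp)).contDiffAt (x := (t, u, v))).div
      ((contDiffAt_const (c := (2 : ℝ))).mul (hA1.mul hS))
      (mul_pos two_pos (mul_pos hpos (Real.sqrt_pos.2 hpos))).ne'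
    exact ((((contDiff_polynomial_eval E).of_le (by simp)).contDiffAt).comp
      ((t, u, v) : ℝ × ℝ × ℝ) hq).mul hS
  · have hw := add_mul_cos_pos hr.le har u
    refine (hasDerivAt_energyDensity (a := a) (r := r) (c := Real.cos u) (s := Real.sin u)
      (Ω := F (u, v)) (Ωu := Fu (u, v)) (Ωv := Fv (u, v)) (Ωuu := Fuu (u, v))
      (Ωuv := Fuv (u, v)) (Ωvv := Fvv (u, v)) E hr hw).congr_deriv ?_
    rw [energyVariation, eval_reducedEnergy E hr.ne' hw.ne',
      eval_derivative_reducedEnergy E (hr.trans har).ne' hr.ne' hw.ne']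
    field_simp

theorem hasDerivAt_integral_volume (hF : ContDiff ℝ ∞ F) :
    HasDerivAt (fun t => ∫ u in (0 : ℝ)..(2 * Real.pi), ∫ v in (0 : ℝ)..(2 * Real.pi),
        (a * (r - t * F (u, v)) ^ 2 / 2 + Real.cos u * (r - t * F (u, v)) ^ 3 / 3))
      (∫ u in (0 : ℝ)..(2 * Real.pi), ∫ v in (0 : ℝ)..(2 * Real.pi),
        -(r * (a + r * Real.cos u) * F (u, v))) 0 := by
  have hV : ContDiff ℝ ∞ fun z : ℝ × ℝ × ℝ => a * (r - z.1 * F z.2) ^ 2 / 2 +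
      Real.cos z.2.1 * (r - z.1 * F z.2) ^ 3 / 3 := by fun_prop
  refine hasDerivAt_intervalIntegral_intervalIntegral
    (f' := fun q => -(r * (a + r * Real.cos q.1) * F q)) one_pos
    (fun t u v _ => (hV.of_le (by simp)).contDiffAt) (fun u v => ?_)
    Real.two_pi_pos.le Real.two_pi_pos.le
  have l : HasDerivAt (fun t : ℝ => r - t * F (u, v)) (-F (u, v)) 0 := by
    simpa using ((hasDerivAt_id (0 : ℝ)).mul_const (F (u, v))).const_sub r
  refine ((((l.pow 2).const_mul a).div_const 2).add
    (((l.pow 3).const_mul (Real.cos u)).div_const 3)).congr_deriv ?_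
  simp
  ring

/-- The part of the first variation that is a divergence in the direction of `u`. -/
def divergenceU (a r : ℝ) (G : Polynomial ℝ) (F Fu Fuu : ℝ × ℝ → ℝ) (q : ℝ × ℝ) : ℝ :=
  1 / (2 * r) *
    (G.eval (a + r * Real.cos q.1)⁻¹ *
        ((a + r * Real.cos q.1) * Fuu q - r * Real.sin q.1 * Fu q) -
      (G.derivative.derivative.eval (a + r * Real.cos q.1)⁻¹ *
          (r ^ 2 * (1 - Real.cos q.1 ^ 2) * (a + r * Real.cos q.1)⁻¹ ^ 3) +
        G.derivative.eval (a + r * Real.cos q.1)⁻¹ *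
          (r * Real.cos q.1 * (a + r * Real.cos q.1)⁻¹ +
            r ^ 2 * (1 - Real.cos q.1 ^ 2) * (a + r * Real.cos q.1)⁻¹ ^ 2)) * F q)

theorem hasDerivAt_inv_add_mul_cos (hr : 0 < r) (har : r < a) (u : ℝ) :
    HasDerivAt (fun u => (a + r * Real.cos u)⁻¹)
      (r * Real.sin u * (a + r * Real.cos u)⁻¹ ^ 2) u := by
  have hw := (add_mul_cos_pos hr.le har u).ne'
  refine ((((Real.hasDerivAt_cos u).const_mul r).const_add a).inv hw).congr_deriv ?_
  field_simp

theorem continuous_inv_add_mul_cos (hr : 0 < r) (har : r < a) :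
    Continuous fun q : ℝ × ℝ => (a + r * Real.cos q.1)⁻¹ :=
  Continuous.inv₀ (by fun_prop) fun q => (add_mul_cos_pos hr.le har q.1).ne'

theorem continuous_eval_inv_add_mul_cos (hr : 0 < r) (har : r < a) (Q : Polynomial ℝ) :
    Continuous fun q : ℝ × ℝ => Q.eval (a + r * Real.cos q.1)⁻¹ :=
  Q.continuous.comp (continuous_inv_add_mul_cos hr har)

theorem continuous_divergenceU (hr : 0 < r) (har : r < a) (G : Polynomial ℝ)
    (hF : IsJet F Fu Fv Fuu Fuv Fvv) : Continuous (divergenceU a r G F Fu Fuu) := by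
  have c0 := hF.smooth.continuous
  have c1 := hF.smooth_u.continuous
  have c2 := hF.smooth_uu.continuous
  have cy := continuous_inv_add_mul_cos hr har
  have g0 := continuous_eval_inv_add_mul_cos hr har G
  have g1 := continuous_eval_inv_add_mul_cos hr har G.derivative
  have g2 := continuous_eval_inv_add_mul_cos hr har G.derivative.derivative
  unfold divergenceU
  exact continuous_const.mul ((g0.mul (by fun_prop)).sub
    (((g2.mul (Continuous.mul (by fun_prop) (cy.pow 3))).add (g1.mul
      ((Continuous.mul (by fun_prop) cy).add (Continuous.mul (by fun_prop) (cy.pow 2))))).mul c0))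

/-- With `w = a + r cos u`, the integrand is the `u`-derivative of `(G w F_u - w G_u F)/(2r)`, the
flux in Green's identity, and this flux is periodic. -/
theorem integral_divergenceU (hr : 0 < r) (har : r < a) (G : Polynomial ℝ)
    (hF : IsJet F Fu Fv Fuu Fuv Fvv) (hp : ∀ u v, F (u + 2 * Real.pi, v) = F (u, v)) :
    ∫ u in (0 : ℝ)..(2 * Real.pi), ∫ v in (0 : ℝ)..(2 * Real.pi),
      divergenceU a r G F Fu Fuu (u, v) = 0 := by
  have cU := continuous_divergenceU hr har G hF
  rw [intervalIntegral_swap_of_continuous cU Real.two_pi_pos.le Real.two_pi_pos.le]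
  have : ∀ v, ∫ u in (0 : ℝ)..(2 * Real.pi), divergenceU a r G F Fu Fuu (u, v) = 0 := by
    intro v
    refine integral_deriv_periodic_eq_zero (f := fun u => 1 / (2 * r) *
      (G.eval (a + r * Real.cos u)⁻¹ * ((a + r * Real.cos u) * Fu (u, v)) -
        G.derivative.eval (a + r * Real.cos u)⁻¹ *
          (r * Real.sin u * (a + r * Real.cos u)⁻¹) * F (u, v))) (fun u => ?_)
      (cU.comp (f := fun u => (u, v)) (by fun_prop)) ?_
    · have hy := hasDerivAt_inv_add_mul_cos hr har u
      have g0 := (G.hasDerivAt (a + r * Real.cos u)⁻¹).comp u hy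
      have g1 := (G.derivative.hasDerivAt (a + r * Real.cos u)⁻¹).comp u hy
      have hwd := ((Real.hasDerivAt_cos u).const_mul r).const_add a
      refine (((g0.mul (hwd.mul (hF.hasDerivAt_uu u v))).sub
        ((g1.mul (((Real.hasDerivAt_sin u).const_mul r).mul hy)).mul
          (hF.hasDerivAt_u u v))).const_mul (1 / (2 * r))).congr_deriv ?_
      simp only [divergenceU, Function.comp_apply, Pi.mul_apply]
      rw [← Real.sin_sq u]
      linear_combination (1 / (2 * r)) * (G.derivative.eval (a + r * Real.cos u)⁻¹ * r *
        Real.sin u * (a + r * Real.cos u)⁻¹ * Fu (u, v)) *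
        mul_inv_cancel₀ (add_mul_cos_pos hr.le har u).ne'
    · have hper : Fu (2 * Real.pi, v) = Fu (0, v) := by
        have h1 := (hF.hasDerivAt_u (0 + 2 * Real.pi) v).comp_add_const 0 (2 * Real.pi)
        simp only [hp] at h1
        simpa using h1.unique (hF.hasDerivAt_u 0 v)
      have hFper : F (2 * Real.pi, v) = F (0, v) := by simpa using hp 0 v
      simp [hper, hFper]
  simp [this]

/-- Integration by parts in pointwise form: the variation is the Euler–Lagrange expression times `F`
and the area density, plus two terms with zero integral. -/
theorem energyVariation_eq (hr : 0 < r) (har : r < a) (E : Polynomial ℝ) (p : ℝ) (q : ℝ × ℝ) :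
    energyVariation a r E F Fu Fuu Fvv q + p * -(r * (a + r * Real.cos q.1) * F q) =
      r * (a + r * Real.cos q.1) *
          ((eulerOp a r (reducedEnergy a r E)).eval (a + r * Real.cos q.1)⁻¹ - p) * F q +
        (divergenceU a r (Polynomial.C (-(2 * r / a)) * (reducedEnergy a r E).derivative)
            F Fu Fuu q +
          (Polynomial.C (-(2 * r / a)) * (reducedEnergy a r E).derivative).eval
            (a + r * Real.cos q.1)⁻¹ * (r * (a + r * Real.cos q.1)⁻¹ / 2) * Fvv q) := by
  have hwq := (add_mul_cos_pos hr.le har q.1).ne'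
  set e := reducedEnergy a r E
  set G : Polynomial ℝ := Polynomial.C (-(2 * r / a)) * e.derivative with hG
  have hL (y : ℝ) : (eulerOp a r e).eval y = 1 / (2 * r ^ 2) *
      (((r ^ 2 - a ^ 2) * y ^ 4 + 2 * a * y ^ 3 - y ^ 2) * G.derivative.derivative.eval y +
        ((r ^ 2 - a ^ 2) * y ^ 3 + a * y ^ 2) * G.derivative.eval y) +
      (a ^ 2 / (2 * r ^ 2) * y ^ 2 - a / r ^ 2 * y + 1 / r ^ 2) * G.eval y -
      (2 / r - a / r * y) * e.eval y := by
    simp only [eulerOp, LinearMap.coe_mk, AddHom.coe_mk, ← hG, Polynomial.eval_add,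
      Polynomial.eval_sub, Polynomial.eval_mul, Polynomial.eval_pow, Polynomial.eval_C,
      Polynomial.eval_X]
  rw [hL, energyVariation, divergenceU, ← hG]
  generalize G.derivative.derivative.eval (a + r * Real.cos q.1)⁻¹ = G₂
  generalize G.derivative.eval (a + r * Real.cos q.1)⁻¹ = G₁
  generalize G.eval (a + r * Real.cos q.1)⁻¹ = G₀
  generalize Polynomial.eval (a + r * Real.cos q.1)⁻¹ _ = e₀
  generalize Real.cos q.1 = c at *
  obtain ⟨w, hw⟩ : ∃ w, w = a + r * c := ⟨_, rfl⟩
  rw [show a + 2 * r * c = w + r * c by linarith]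
  simp only [← hw] at hwq ⊢
  rw [show a = w - r * c by linarith]
  field_simp
  ring

theorem integral_energyVariation (hr : 0 < r) (har : r < a) (E : Polynomial ℝ) (p : ℝ)
    (hF : IsJet F Fu Fv Fuu Fuv Fvv) (hpu : ∀ u v, F (u + 2 * Real.pi, v) = F (u, v))
    (hpv : ∀ u v, F (u, v + 2 * Real.pi) = F (u, v)) :
    (∫ u in (0 : ℝ)..(2 * Real.pi), ∫ v in (0 : ℝ)..(2 * Real.pi),
        energyVariation a r E F Fu Fuu Fvv (u, v)) +
      p * (∫ u in (0 : ℝ)..(2 * Real.pi), ∫ v in (0 : ℝ)..(2 * Real.pi),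
        -(r * (a + r * Real.cos u) * F (u, v))) =
      ∫ u in (0 : ℝ)..(2 * Real.pi), ∫ v in (0 : ℝ)..(2 * Real.pi),
        r * (a + r * Real.cos u) *
          ((eulerOp a r (reducedEnergy a r E)).eval (a + r * Real.cos u)⁻¹ - p) * F (u, v) := by
  have h2π := Real.two_pi_pos.le
  set G : Polynomial ℝ := Polynomial.C (-(2 * r / a)) * (reducedEnergy a r E).derivative
  have c0 := hF.smooth.continuous
  have c3 := hF.smooth_vv.continuous
  have cy := continuous_inv_add_mul_cos hr har
  have cU := continuous_divergenceU hr har G hF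
  have cW : Continuous fun q : ℝ × ℝ => G.eval (a + r * Real.cos q.1)⁻¹ *
      (r * (a + r * Real.cos q.1)⁻¹ / 2) * Fvv q :=
    ((continuous_eval_inv_add_mul_cos hr har G).mul
      ((continuous_const.mul cy).div_const 2)).mul c3
  have cM : Continuous fun q : ℝ × ℝ => r * (a + r * Real.cos q.1) *
      ((eulerOp a r (reducedEnergy a r E)).eval (a + r * Real.cos q.1)⁻¹ - p) * F q :=
    (Continuous.mul (by fun_prop)
      ((continuous_eval_inv_add_mul_cos hr har _).sub continuous_const)).mul c0
  have cV : Continuous fun q : ℝ × ℝ => p * -(r * (a + r * Real.cos q.1) * F q) := by fun_prop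
  have cD : Continuous (energyVariation a r E F Fu Fuu Fvv) := by
    have : energyVariation a r E F Fu Fuu Fvv =
        fun q => _ - p * -(r * (a + r * Real.cos q.1) * F q) :=
      funext fun q => eq_sub_of_add_eq (energyVariation_eq hr har E p q)
    rw [this]
    exact (cM.add (cU.add cW)).sub cV
  have hW0 : ∫ u in (0 : ℝ)..(2 * Real.pi), ∫ v in (0 : ℝ)..(2 * Real.pi),
      G.eval (a + r * Real.cos u)⁻¹ * (r * (a + r * Real.cos u)⁻¹ / 2) * Fvv (u, v) = 0 := by
    have (u : ℝ) : ∫ v in (0 : ℝ)..(2 * Real.pi), Fvv (u, v) = 0 := by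
      refine integral_deriv_periodic_eq_zero (fun v => hF.hasDerivAt_vv u v)
        (c3.comp (f := fun v => (u, v)) (by fun_prop)) ?_
      have h1 := (hF.hasDerivAt_v u (0 + 2 * Real.pi)).comp_add_const 0 (2 * Real.pi)
      simp only [hpv] at h1
      simpa using h1.unique (hF.hasDerivAt_v u 0)
    simp [this]
  have s1 := intervalIntegral_intervalIntegral_add cD cV h2π h2π
  have s2 := intervalIntegral_intervalIntegral_add cM (cU.add cW) h2π h2π
  have s3 := intervalIntegral_intervalIntegral_add cU cW h2π h2π
  have e : ∫ u in (0 : ℝ)..(2 * Real.pi), ∫ v in (0 : ℝ)..(2 * Real.pi),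
      (energyVariation a r E F Fu Fuu Fvv (u, v) +
        p * -(r * (a + r * Real.cos u) * F (u, v))) = _ :=
    intervalIntegral.integral_congr fun u _ => intervalIntegral.integral_congr fun v _ =>
      energyVariation_eq hr har E p (u, v)
  rw [integral_divergenceU hr har G hF hpu, hW0, add_zero] at s3
  have s4 := s1.symm.trans (e.trans (s2.trans (congrArg (_ + ·) s3)))
  rw [add_zero] at s4
  simpa only [intervalIntegral.integral_const_mul] using s4

end

/-- The first variation of the shape energy of the torus. -/
theorem hasDerivAt_shapeEnergy {a r : ℝ} (hr : 0 < r) (har : r < a) (E : Polynomial ℝ) (p : ℝ)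
    {Ω : ℝ → ℝ → ℝ} (hΩ : IsSmoothPeriodic Ω) :
    HasDerivAt (fun t => shapeEnergy E p (normalVariation (torus a r) Ω t))
      (∫ u in (0 : ℝ)..(2 * Real.pi), ∫ v in (0 : ℝ)..(2 * Real.pi),
        r * (a + r * Real.cos u) *
          ((eulerOp a r (reducedEnergy a r E)).eval (a + r * Real.cos u)⁻¹ - p) * Ω u v) 0 := by
  obtain ⟨δ, hδ, hρ⟩ := exists_forall_abs_lt_radius_mem hr har hΩ
  obtain ⟨hsm, hpu, hpv⟩ := hΩ
  obtain ⟨Ωu, Ωv, Ωuu, Ωuv, Ωvv, hjet⟩ := exists_isJet hsm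
  have h1 := hasDerivAt_integral_energy hr har E hjet hδ (fun t ht q => hρ t ht q.1 q.2)
  have h2 := hasDerivAt_integral_volume (a := a) (r := r) hsm
  rw [← integral_energyVariation hr har E p hjet hpu hpv]
  refine (h1.add (h2.const_mul p)).congr_of_eventuallyEq ?_
  filter_upwards [Metric.ball_mem_nhds (0 : ℝ) hδ] with t ht
  rw [mem_ball_zero_iff, Real.norm_eq_abs] at ht
  rw [shapeEnergy, normalVariation_torus hr har,
    enclosedVolume_tube (ρ := fun u v => r - t * Ω u v) (by simp [hpu]) (by simp [hpv])
      (continuous_const.sub (continuous_const.mul hsm.continuous)) (fun u v => (hρ t ht u v).1)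
      (fun u v => (hρ t ht u v).2)]
  rfl

/-- The torus is critical if and only if the Euler–Lagrange polynomial is constant. -/
theorem isCriticalPoint_torus_iff {a r : ℝ} (hr : 0 < r) (har : r < a) (E : Polynomial ℝ)
    (p : ℝ) :
    IsCriticalPoint E p (torus a r) ↔
      eulerOp a r (reducedEnergy a r E) = Polynomial.C p := by
  have hw := add_mul_cos_pos hr.le har
  constructor
  · intro hcrit
    -- The Euler–Lagrange density is itself an admissible `Ω`; the first variation along it is the
    -- integral of `M²`, which forces `M = 0`.
    set M : ℝ → ℝ := fun u => r * (a + r * Real.cos u) *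
      ((eulerOp a r (reducedEnergy a r E)).eval (a + r * Real.cos u)⁻¹ - p) with hM
    have hMs : ContDiff ℝ ∞ M := by
      have hy : ContDiff ℝ ∞ fun u => (a + r * Real.cos u)⁻¹ :=
        ContDiff.inv (by fun_prop) fun u => (hw u).ne'
      exact ContDiff.mul (by fun_prop)
        (((contDiff_polynomial_eval _).comp hy).sub contDiff_const)
    have hΩ : IsSmoothPeriodic fun u _ => M u :=
      ⟨hMs.comp contDiff_fst, fun u v => by simp [hM], fun u v => rfl⟩
    have h0 := (hasDerivAt_shapeEnergy hr har E p hΩ).unique (hcrit _ hΩ)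
    have hM0 : ∀ u ∈ Icc 0 (2 * Real.pi), M u = 0 := by
      by_contra! hne
      obtain ⟨u, hu, hMu⟩ := hne
      have hpos : 0 < ∫ u in (0 : ℝ)..(2 * Real.pi), ∫ _ in (0 : ℝ)..(2 * Real.pi), M u * M u := by
        simp only [intervalIntegral.integral_const, sub_zero, smul_eq_mul]
        refine intervalIntegral.integral_pos Real.two_pi_pos ?_ (fun x _ => ?_) ⟨u, hu, ?_⟩
        · have := hMs.continuous
          fun_prop
        · exact mul_nonneg Real.two_pi_pos.le (mul_self_nonneg _)
        · exact mul_pos Real.two_pi_pos (mul_self_pos.2 hMu)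
      exact hpos.ne' h0
    refine Polynomial.eq_of_infinite_eval_eq _ _ ?_
    -- On half a period `cos` is injective, so the polynomials agree at infinitely many values of
    -- `y`.
    have hinj : InjOn (fun u => (a + r * Real.cos u)⁻¹) (Icc 0 Real.pi) := by
      intro x hx x' hx' h
      have h1 := inv_injective h
      exact Real.injOn_cos hx hx' (mul_left_cancel₀ hr.ne' (add_left_cancel h1))
    refine ((Icc_infinite Real.pi_pos).image hinj).mono ?_
    rintro _ ⟨u, hu, rfl⟩
    have h1 := hM0 u ⟨hu.1, hu.2.trans (by linarith [Real.pi_pos])⟩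
    have h2 := (mul_eq_zero.1 h1).resolve_left (mul_pos hr (hw u)).ne'
    simpa [sub_eq_zero] using h2
  · intro h Ω hΩ
    simpa [h] using hasDerivAt_shapeEnergy hr har E p hΩ

/-! ### Passing between polynomials in `H` and in `y`, and the equivalence. -/

open Polynomial in
theorem natDegree_reducedEnergy {a r : ℝ} (ha : a ≠ 0) (hr : r ≠ 0) (E : ℝ[X]) :
    (reducedEnergy a r E).natDegree = E.natDegree := by
  have h : (C (1 / r) - C (a / (2 * r)) * X : ℝ[X]).natDegree = 1 := by
    rw [sub_eq_neg_add, ← neg_mul, ← C_neg]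
    exact natDegree_linear (neg_ne_zero.2 (div_ne_zero ha (mul_ne_zero two_ne_zero hr)))
  rw [reducedEnergy, natDegree_comp, h, mul_one]

open Polynomial in
theorem leadingCoeff_reducedEnergy {a r : ℝ} (ha : a ≠ 0) (hr : r ≠ 0) (E : ℝ[X]) :
    (reducedEnergy a r E).leadingCoeff = E.leadingCoeff * (-(a / (2 * r))) ^ E.natDegree := by
  have h0 : -(a / (2 * r)) ≠ 0 := neg_ne_zero.2 (div_ne_zero ha (mul_ne_zero two_ne_zero hr))
  have h : (C (1 / r) - C (a / (2 * r)) * X : ℝ[X]) = C (-(a / (2 * r))) * X + C (1 / r) := by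
    rw [C_neg]; ring
  rw [reducedEnergy, h, leadingCoeff_comp (by rw [natDegree_linear h0]; exact one_ne_zero),
    leadingCoeff_linear h0]

open Polynomial in
theorem reducedEnergy_surjective {a r : ℝ} (ha : a ≠ 0) (hr : r ≠ 0) (e : ℝ[X]) :
    ∃ E, reducedEnergy a r E = e := by
  -- This is `H = 1/r - a y/(2r)` solved for `y`.
  refine ⟨e.comp (C (2 / a) - C (2 * r / a) * X), ?_⟩
  rw [reducedEnergy, comp_assoc]
  have : ((C (2 / a) - C (2 * r / a) * X : ℝ[X]).comp
      (C (1 / r) - C (a / (2 * r)) * X)) = X := by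
    refine Polynomial.funext fun x => ?_
    simp only [eval_comp, eval_sub, eval_mul, eval_C, eval_X]
    field_simp
    ring
  rw [this, comp_X]

theorem ratio_eq_iff {a r : ℝ} (hr : 0 < r) {n : ℕ} (hn : 2 ≤ n) :
    a ^ 2 / r ^ 2 = ((n : ℝ) ^ 2 - n) / ((n : ℝ) ^ 2 - n - 1) ↔
      (n : ℝ) * (n - 1) * (a ^ 2 - r ^ 2) = a ^ 2 := by
  have hn' : (2 : ℝ) ≤ n := by exact_mod_cast hn
  have h1 : (n : ℝ) ^ 2 - n - 1 ≠ 0 := by nlinarith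
  rw [div_eq_div_iff (by positivity) h1]
  constructor <;> intro h <;> linarith

end ToroidalSurface

end

open ToroidalSurface in
theorem theorem1 (n : ℕ) (hn : 2 ≤ n) (a r : ℝ) (hr : 0 < r) (har : r < a)
    (a₁ : ℝ) (ha₁ : a₁ ≠ 0) :
    (∃ (E : Polynomial ℝ) (p : ℝ), E.natDegree = n ∧ E.leadingCoeff = a₁ ∧
        ToroidalSurface.IsCriticalPoint E p (ToroidalSurface.torus a r)) ↔
      a ^ 2 / r ^ 2 = ((n : ℝ) ^ 2 - n) / ((n : ℝ) ^ 2 - n - 1) := by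
  have ha : a ≠ 0 := (hr.trans har).ne'
  have hc : -(a / (2 * r)) ≠ 0 := neg_ne_zero.2 (div_ne_zero ha (by positivity))
  simp only [isCriticalPoint_torus_iff hr har, ratio_eq_iff hr hn]
  constructor
  · rintro ⟨E, p, hdeg, hlead, h⟩
    have hdeg' : (reducedEnergy a r E).natDegree = n := by
      rw [natDegree_reducedEnergy ha hr.ne', hdeg]
    have h1 := coeff_eulerOp_natDegree_succ ha hr.ne' (e := reducedEnergy a r E) (by omega)
    -- The coefficient of degree `n + 1` of a constant is zero, so the top coefficient must vanish.
    rw [h, Polynomial.coeff_C_succ, leadingCoeff_reducedEnergy ha hr.ne', hlead, hdeg', hdeg] at h1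
    have h2 := (mul_eq_zero.1 h1.symm).resolve_left (mul_ne_zero ha₁ (pow_ne_zero _ hc))
    have h3 := (div_eq_zero_iff.1 h2).resolve_right (mul_ne_zero ha hr.ne')
    have hn' : (2 : ℝ) ≤ n := by exact_mod_cast hn
    exact sub_eq_zero.1 ((mul_eq_zero.1 h3).resolve_left (by linarith))
  · intro h
    -- The leading coefficient in `y` is prescribed as `a₁ (-a/(2r))^n`, so that the one in `H` is
    -- `a₁`.
    obtain ⟨e, p, hdeg, hlead, he⟩ := exists_eulerOp_eq_C hr har hn h
      (mul_ne_zero ha₁ (pow_ne_zero n hc))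
    obtain ⟨E, rfl⟩ := reducedEnergy_surjective ha hr.ne' e
    rw [natDegree_reducedEnergy ha hr.ne'] at hdeg
    rw [leadingCoeff_reducedEnergy ha hr.ne', hdeg] at hlead
    exact ⟨E, p, hdeg, mul_right_cancel₀ (pow_ne_zero n hc) hlead, he⟩
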